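/- Let $\mathbb{K}$ be a field of characteristic zero, let $\mathfrak{h}=\mathbb{K}\langle x,y\rangle$, $\mathfrak{h}^1=\mathbb{K}+\mathfrak{h}y$, $\mathfrak{h}^0=\mathbb{K}+x\mathfrak{h}y$ and $z_k=x^{k-1}y$ for $k\ge 1$. The shuffle product on $\mathfrak{h}$ is the bilinear product with $1\sqcup\!\sqcup w=w\sqcup\!\sqcup 1=w$ and $au\sqcup\!\sqcup bv=a(u\sqcup\!\sqcup bv)+b(au\sqcup\!\sqcup v)$ for letters $a,b$ and words $u,v$. The stuffle product on $\mathfrak{h}^1$ is the bilinear product with $1*w=w*1=w$ and $z_ku*z_lv=z_k(u*z_lv)+z_l(z_ku*v)+z_{k+l}(u*v)$. Every $w\in\mathfrak{h}^1$ is uniquely a finite sum $\sum_{i\ge 0}w_i\sqcup\!\sqcup y^{\sqcup\!\sqcup\, i}$ with $w_i\in\mathfrak{h}^0$; put $\mathrm{reg}_{\sqcup\!\sqcup}(w)=w_0$. Let $R$ be a commutative unital $\mathbb{K}$-algebra and $Z_R:\mathfrak{h}^0\to R$ a $\mathbb{K}$-linear map that satisfies the regularized double shuffle relations: $Z_R(1)=1$,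 $Z_R(u\sqcup\!\sqcup v)=Z_R(u)Z_R(v)=Z_R(u*v)$ for all $u,v\in\mathfrak{h}^0$, and $Z_R(\mathrm{reg}_{\sqcup\!\sqcup}(w_1\sqcup\!\sqcup w_0-w_1*w_0))=0$ for all $w_1\in\mathfrak{h}^1$, $w_0\in\mathfrak{h}^0$. Let $\sigma$ be the algebra automorphism of $\mathfrak{h}$ with $\sigma(x)=x$, $\sigma(y)=x+y$, and let $S$ be the linear map with $S(1)=1$ and $S(wa)=\sigma(w)a$ for words $w$ and letters $a$. For $k_1\ge 2$ and $k_2,\dots,k_n\ge 1$ put $\zeta_R(k_1,\dots,k_n)=Z_R(z_{k_1}\cdots z_{k_n})$ and $\zeta_R^\star(k_1,\dots,k_n)=Z_R(S(z_{k_1}\cdots z_{k_n}))$. Let $\lambda$, an element of $R$ or of some commutative $R$-algebra, satisfy $\lambda^2=-24\,\zeta_R(2)$. Let $B_j$ be the Bernoulli numbers, $\sum_{j\ge0} B_jt^j/j!=t/(e^t-1)$, and $\rho_m=e^{\pi\sqrt{-1}/m}$. Equalities below are in the algebra that contains $\lambda$. Then for all integers $m\ge 1$ and $k\ge n\ge 1$,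 $$\sum_{\substack{k_1+\cdots+k_n=k\\ k_i\ge1}}\zeta_R(2mk_1,\dots,2mk_n)=C_{m,k,n}\,\frac{\lambda^{2km}}{4^{km}},\qquad \sum_{\substack{k_1+\cdots+k_n=k\\ k_i\ge1}}\zeta_R^\star(2mk_1,\dots,2mk_n)=C^\star_{m,k,n}\,\frac{\lambda^{2km}}{4^{km}},$$ where $$C_{m,k,n}=(-1)^n\sum_{j=0}^{k-n}\binom{k-j}{n}D_{m,j,k-j},\qquad C^\star_{m,k,n}=\sum_{j=n}^{k}\binom{j}{n}D_{m,j,k-j},$$ $$D_{m,p,q}=\sum_{\substack{n_0+\cdots+n_{m-1}=mp\\ l_0+\cdots+l_{m-1}=mq\\ n_i,l_i\ge0}}\left[\prod_{i=0}^{m-1}\frac{(2-4^{n_i})B_{2n_i}}{(2n_i)!\,(2l_i+1)!}\right]\rho_m^{\sum_{i=0}^{m-1}2i(n_i+l_i)},$$ and the complex numbers $C_{m,k,n}$ and $C^\star_{m,k,n}$ are rational (so that the right-hand sides make sense). In particular, for $m=1$ (Hoffman's formula and its star analogue), $$\sum_{\substack{k_1+\cdots+k_n=k\\ k_i\ge1}}\zeta_R(2k_1,\dots,2k_n)=\frac{(-1)^n\lambda^{2k}}{4^k(2k+1)!}\sum_{j=0}^{k-n}\binom{k-j}{n}\binom{2k+1}{2j}(2-4^j)B_{2j},$$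 $$\sum_{\substack{k_1+\cdots+k_n=k\\ k_i\ge1}}\zeta_R^\star(2k_1,\dots,2k_n)=\frac{\lambda^{2k}}{4^k(2k+1)!}\sum_{j=n}^{k}\binom{j}{n}\binom{2k+1}{2j}(2-4^j)B_{2j},$$ and for $m=2$ (the formula conjectured by Genčev and its star analogue), with $b_j=\sum_{i=0}^{2j}(-1)^i\binom{4j}{2i}(2-4^i)(2-4^{2j-i})B_{2i}B_{4j-2i}$, $$\sum_{\substack{k_1+\cdots+k_n=k\\ k_i\ge1}}\zeta_R(4k_1,\dots,4k_n)=(-1)^{k+n}\frac{2\lambda^{4k}}{4^k(4k+2)!}\sum_{j=0}^{k-n}\frac{(-1)^j}{4^j}\binom{k-j}{n}\binom{4k+2}{4j}b_j,$$ $$\sum_{\substack{k_1+\cdots+k_n=k\\ k_i\ge1}}\zeta_R^\star(4k_1,\dots,4k_n)=(-1)^{k}\frac{2\lambda^{4k}}{4^k(4k+2)!}\sum_{j=n}^{k}\frac{(-1)^j}{4^j}\binom{j}{n}\binom{4k+2}{4j}b_j.$$ -/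

import Mathlib

open scoped Nat

namespace MZV

/-- The alphabet `A = {x, y}`. -/
inductive Letter : Type
  | x
  | y

/-- The algebra `𝔥 = K⟨x, y⟩` of noncommutative polynomials. -/
abbrev H (K : Type*) [Field K] : Type _ := FreeAlgebra K Letter

section Words

variable (K : Type*) [Field K]

/-- The letter `a`, as an element of `𝔥`. -/
noncomputable def letter (a : Letter) : H K := FreeAlgebra.ι K a

/-- The word `a₁ a₂ ⋯ aᵣ`, as an element of `𝔥`. -/
noncomputable def word (w : List Letter) : H K := (w.map (letter K)).prod

/-- The basis of `𝔥` given by the words. -/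
noncomputable def wordBasis : Module.Basis (List Letter) K (H K) :=
  (FreeAlgebra.basisFreeMonoid K Letter).reindex FreeMonoid.toList

theorem wordBasis_apply (w : List Letter) : wordBasis K w = word K w := by
  have h : wordBasis K w = FreeAlgebra.equivMonoidAlgebraFreeMonoid.symm
      (MonoidAlgebra.single (FreeMonoid.ofList w) (1 : K)) := by
    simp only [wordBasis, FreeAlgebra.basisFreeMonoid, Module.Basis.reindex_apply,
      Module.Basis.map_apply, Finsupp.coe_basisSingleOne]
    rfl
  rw [h]
  change MonoidAlgebra.lift K (FreeAlgebra K Letter) (FreeMonoid Letter)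
    (FreeMonoid.lift (FreeAlgebra.ι K)) _ = _
  rw [MonoidAlgebra.lift_single, one_smul, FreeMonoid.lift_apply, FreeMonoid.toList_ofList]
  rfl

theorem word_nil : word K [] = 1 := rfl

theorem word_cons (a : Letter) (w : List Letter) : word K (a :: w) = letter K a * word K w := by
  simp [word]

theorem word_append (u v : List Letter) : word K (u ++ v) = word K u * word K v := by
  simp [word]

/-- `z_k = x^{k-1} y`, for `k ≥ 1`. -/
noncomputable def z (k : ℕ) : H K := letter K .x ^ (k - 1) * letter K .y

/-- `z_{k₁} z_{k₂} ⋯ z_{kₙ}`. -/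
noncomputable def zWord (k : List ℕ) : H K := (k.map (z K)).prod

/-- `𝔥¹ = K + 𝔥 y`. -/
noncomputable def h1 : Submodule K (H K) :=
  (1 : Submodule K (H K)) ⊔ LinearMap.range (LinearMap.mulRight K (letter K .y))

/-- `𝔥⁰ = K + x 𝔥 y`. -/
noncomputable def h0 : Submodule K (H K) :=
  (1 : Submodule K (H K)) ⊔
    LinearMap.range (LinearMap.mulLeft K (letter K .x) ∘ₗ LinearMap.mulRight K (letter K .y))

/-- The shuffle product of two words:
`1 ⧢ w = w ⧢ 1 = w` and `au ⧢ bv = a (u ⧢ bv) + b (au ⧢ v)`. -/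
noncomputable def shuffleWord : List Letter → List Letter → H K
  | [], v => word K v
  | a :: u, [] => word K (a :: u)
  | a :: u, b :: v =>
      letter K a * shuffleWord u (b :: v) + letter K b * shuffleWord (a :: u) v
termination_by u v => u.length + v.length

/-- The shuffle product `⧢` on `𝔥`. -/
noncomputable def shuffle : H K →ₗ[K] H K →ₗ[K] H K :=
  (wordBasis K).constr K fun u => (wordBasis K).constr K fun v => shuffleWord K u v

/-- The stuffle product of two words `z_{k₁} ⋯ z_{kₙ}` and `z_{l₁} ⋯ z_{lₚ}`, given by their
indices: `1 ∗ w = w ∗ 1 = w` and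
`z_k u ∗ z_l v = z_k (u ∗ z_l v) + z_l (z_k u ∗ v) + z_{k+l} (u ∗ v)`. -/
noncomputable def stuffleIndex : List ℕ → List ℕ → H K
  | [], l => zWord K l
  | k :: u, [] => zWord K (k :: u)
  | k :: u, l :: v =>
      z K k * stuffleIndex u (l :: v) + z K l * stuffleIndex (k :: u) v
        + z K (k + l) * stuffleIndex u v
termination_by u v => u.length + v.length

/-- The index `(k₁, …, kₙ)` of the word `z_{k₁} ⋯ z_{kₙ}`, when the letters are read from the left
and `r` letters `x` have already been read. (Letters `x` at the end, which do not occur in the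
words of `𝔥¹`, are dropped.) -/
def indexAux : ℕ → List Letter → List ℕ
  | _, [] => []
  | r, .x :: w => indexAux (r + 1) w
  | r, .y :: w => (r + 1) :: indexAux 0 w

/-- The stuffle product `∗`. It is meaningful on the subspace `𝔥¹`, and is only used there. -/
noncomputable def stuffle : H K →ₗ[K] H K →ₗ[K] H K :=
  (wordBasis K).constr K fun u => (wordBasis K).constr K fun v =>
    stuffleIndex K (indexAux 0 u) (indexAux 0 v)

/-- The automorphism `σ` of `𝔥` with `σ(x) = x` and `σ(y) = x + y`. -/
noncomputable def sigma : H K →ₐ[K] H K :=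
  FreeAlgebra.lift K fun a => match a with
    | .x => letter K .x
    | .y => letter K .x + letter K .y

/-- The linear map `S` on `𝔥` with `S(1) = 1` and `S(w a) = σ(w) a` for words `w` and letters
`a`. -/
noncomputable def S : H K →ₗ[K] H K :=
  (wordBasis K).constr K fun w => match w.getLast? with
    | none => 1
    | some a => sigma K (word K w.dropLast) * letter K a

end Words

section Lemmas

variable {K : Type*} [Field K]

theorem shuffle_word (u v : List Letter) :
    shuffle K (word K u) (word K v) = shuffleWord K u v := by
  simp only [← wordBasis_apply, shuffle, Module.Basis.constr_basis]

theorem stuffle_word (u v : List Letter) :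
    stuffle K (word K u) (word K v) = stuffleIndex K (indexAux 0 u) (indexAux 0 v) := by
  simp only [← wordBasis_apply, stuffle, Module.Basis.constr_basis]

theorem S_nil : S K 1 = 1 := by
  have h : S K (wordBasis K []) = 1 := by
    rw [S, Module.Basis.constr_basis]
    rfl
  rwa [wordBasis_apply, word_nil] at h

theorem S_concat (w : List Letter) (a : Letter) :
    S K (word K w * letter K a) = sigma K (word K w) * letter K a := by
  have h : word K w * letter K a = word K (w ++ [a]) := by simp [word]
  rw [h, ← wordBasis_apply, S, Module.Basis.constr_basis]
  simp

theorem span_word : Submodule.span K (Set.range (word K)) = ⊤ := by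
  have : word K = wordBasis K := funext fun w => (wordBasis_apply K w).symm
  rw [this]
  exact (wordBasis K).span_eq

/-- Induction over the words. -/
theorem word_induction {p : H K → Prop} (f : H K) (hw : ∀ w, p (word K w))
    (hz : p 0) (ha : ∀ a b, p a → p b → p (a + b)) (hs : ∀ (c : K) a, p a → p (c • a)) : p f := by
  have hf : f ∈ Submodule.span K (Set.range (word K)) := by rw [span_word]; trivial
  induction hf using Submodule.span_induction with
  | mem x hx => obtain ⟨w, rfl⟩ := hx; exact hw w
  | zero => exact hz
  | add a b _ _ h1 h2 => exact ha a b h1 h2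
  | smul c a _ h => exact hs c a h

theorem one_mem_h1 : (1 : H K) ∈ h1 K := Submodule.mem_sup_left (Submodule.one_le.1 le_rfl)

theorem one_mem_h0 : (1 : H K) ∈ h0 K := Submodule.mem_sup_left (Submodule.one_le.1 le_rfl)

theorem mul_y_mem_h1 (f : H K) : f * letter K .y ∈ h1 K :=
  Submodule.mem_sup_right ⟨f, rfl⟩

theorem x_mul_y_mem_h0 (f : H K) : letter K .x * (f * letter K .y) ∈ h0 K :=
  Submodule.mem_sup_right ⟨f, rfl⟩

theorem h0_induction {p : H K → Prop} {f : H K} (hf : f ∈ h0 K) (h1 : p 1)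
    (hw : ∀ w, p (word K (.x :: (w ++ [.y]))))
    (hz : p 0) (ha : ∀ a b, p a → p b → p (a + b)) (hs : ∀ (c : K) a, p a → p (c • a)) : p f := by
  obtain ⟨a, hA, b, ⟨g, rfl⟩, rfl⟩ := Submodule.mem_sup.1 hf
  obtain ⟨c, rfl⟩ := Submodule.mem_one.1 hA
  refine ha _ _ ?_ ?_
  · rw [Algebra.algebraMap_eq_smul_one]; exact hs _ _ h1
  · simp only [LinearMap.comp_apply, LinearMap.mulLeft_apply, LinearMap.mulRight_apply]
    refine word_induction (p := fun g => p (letter K .x * (g * letter K .y))) g ?_ ?_ ?_ ?_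
    · intro w; have := hw w
      simpa [word_cons, word_append, word_nil] using this
    · simpa using hz
    · intro a b h1 h2; simpa [add_mul, mul_add] using ha _ _ h1 h2
    · intro c a h; simpa using hs c _ h

theorem h1_induction {p : H K → Prop} {f : H K} (hf : f ∈ h1 K) (h1 : p 1)
    (hw : ∀ w, p (word K (w ++ [.y])))
    (hz : p 0) (ha : ∀ a b, p a → p b → p (a + b)) (hs : ∀ (c : K) a, p a → p (c • a)) : p f := by
  obtain ⟨a, hA, b, ⟨g, rfl⟩, rfl⟩ := Submodule.mem_sup.1 hf
  obtain ⟨c, rfl⟩ := Submodule.mem_one.1 hA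
  refine ha _ _ ?_ ?_
  · rw [Algebra.algebraMap_eq_smul_one]; exact hs _ _ h1
  · simp only [LinearMap.mulRight_apply]
    refine word_induction (p := fun g => p (g * letter K .y)) g ?_ ?_ ?_ ?_
    · intro w; have := hw w
      simpa [word_cons, word_append, word_nil] using this
    · simpa using hz
    · intro a b h1 h2; simpa [add_mul] using ha _ _ h1 h2
    · intro c a h; simpa using hs c _ h

theorem h0_le_h1 : h0 K ≤ h1 K := by
  intro f hf
  refine h0_induction hf one_mem_h1 ?_ (zero_mem _) (fun _ _ => add_mem)
    (fun c _ => (h1 K).smul_mem c)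
  intro w
  have := mul_y_mem_h1 (K := K) (letter K .x * word K w)
  simpa [word_cons, word_append, word_nil, mul_assoc] using this

/-- The words of `𝔥¹`: the empty word and those which end in `y`. -/
def EndsY (w : List Letter) : Prop := w = [] ∨ ∃ v, w = v ++ [.y]

theorem EndsY.tail {a : Letter} {w : List Letter} (h : EndsY (a :: w)) :
    (w = [] ∧ a = .y) ∨ (w ≠ [] ∧ EndsY w) := by
  rcases h with h | ⟨v, h⟩
  · simp at h
  · cases v with
    | nil => left; simpa [and_comm] using h
    | cons b v =>
      right
      simp only [List.cons_append, List.cons.injEq] at h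
      exact ⟨by simp [h.2], Or.inr ⟨v, h.2⟩⟩

theorem word_mem_range {w : List Letter} (h : EndsY w) (h' : w ≠ []) :
    ∃ f, word K w = f * letter K .y := by
  rcases h with h | ⟨v, rfl⟩
  · exact absurd h h'
  · exact ⟨word K v, by simp [word]⟩

theorem shuffleWord_mem_range : ∀ u v : List Letter, EndsY u → EndsY v → (u ≠ [] ∨ v ≠ []) →
    ∃ f, shuffleWord K u v = f * letter K .y
  | [], v, _, hv, h => by
      rw [shuffleWord]; exact word_mem_range hv (by simpa using h)
  | a :: u, [], hu, _, _ => by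
      rw [shuffleWord]; exact word_mem_range hu (by simp)
  | a :: u, b :: v, hu, hv, _ => by
      have hu' : EndsY u := by
        rcases hu.tail with h | h
        · exact Or.inl h.1
        · exact h.2
      have hv' : EndsY v := by
        rcases hv.tail with h | h
        · exact Or.inl h.1
        · exact h.2
      obtain ⟨f, hf⟩ := shuffleWord_mem_range u (b :: v) hu' hv (by simp)
      obtain ⟨g, hg⟩ := shuffleWord_mem_range (a :: u) v hu hv' (by simp)
      exact ⟨letter K a * f + letter K b * g, by rw [shuffleWord, hf, hg, add_mul, mul_assoc,
        mul_assoc]⟩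
termination_by u v => u.length + v.length

theorem shuffle_mem_h1 {f g : H K} (hf : f ∈ h1 K) (hg : g ∈ h1 K) : shuffle K f g ∈ h1 K := by
  have key : ∀ u v : List Letter, EndsY u → EndsY v →
      shuffle K (word K u) (word K v) ∈ h1 K := by
    intro u v hu hv
    rw [shuffle_word]
    by_cases h : u ≠ [] ∨ v ≠ []
    · obtain ⟨f, hf⟩ := shuffleWord_mem_range (K := K) u v hu hv h
      rw [hf]; exact mul_y_mem_h1 f
    · simp only [ne_eq, not_or, not_not] at h
      rw [h.1, h.2, shuffleWord]; exact one_mem_h1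
  have key2 : ∀ u, EndsY u → shuffle K (word K u) g ∈ h1 K := by
    intro u hu
    refine h1_induction (p := fun g => shuffle K (word K u) g ∈ h1 K) hg (key u [] hu (Or.inl rfl)) (fun w => key u _ hu (Or.inr ⟨w, rfl⟩))
      (by simp) (fun a b h1 h2 => ?_) (fun c a h => ?_)
    · rw [map_add]; exact add_mem h1 h2
    · rw [map_smul]; exact Submodule.smul_mem _ c h
  refine h1_induction (p := fun f => shuffle K f g ∈ h1 K) hf (key2 [] (Or.inl rfl)) (fun w => key2 _ (Or.inr ⟨w, rfl⟩))
    (by simp) (fun a b h1 h2 => ?_) (fun c a h => ?_)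
  · rw [map_add, LinearMap.add_apply]; exact add_mem h1 h2
  · rw [map_smul, LinearMap.smul_apply]; exact Submodule.smul_mem _ c h

theorem shuffleWord_nil_right (u : List Letter) : shuffleWord K u [] = word K u := by
  cases u <;> rw [shuffleWord]

/-- The words of `𝔥⁰`: the empty word and those which start with `x` and end in `y`. -/
def IsAdm (w : List Letter) : Prop := w = [] ∨ ∃ v, w = .x :: (v ++ [.y])

theorem IsAdm.word_mem {w : List Letter} (h : IsAdm w) : word K w ∈ h0 K := by
  rcases h with rfl | ⟨v, rfl⟩
  · exact one_mem_h0
  · have := x_mul_y_mem_h0 (word K v)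
    simpa [word_cons, word_append, word_nil] using this

theorem h0_bilin {B : H K →ₗ[K] H K →ₗ[K] H K}
    (key : ∀ u v : List Letter, IsAdm u → IsAdm v → B (word K u) (word K v) ∈ h0 K)
    {f g : H K} (hf : f ∈ h0 K) (hg : g ∈ h0 K) : B f g ∈ h0 K := by
  have key2 : ∀ u, IsAdm u → B (word K u) g ∈ h0 K := by
    intro u hu
    refine h0_induction (p := fun g => B (word K u) g ∈ h0 K) hg (key u [] hu (Or.inl rfl)) (fun w => key u _ hu (Or.inr ⟨w, rfl⟩))
      (by simp) (fun a b h1 h2 => ?_) (fun c a h => ?_)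
    · rw [map_add]; exact add_mem h1 h2
    · rw [map_smul]; exact Submodule.smul_mem _ c h
  refine h0_induction (p := fun f => B f g ∈ h0 K) hf (key2 [] (Or.inl rfl)) (fun w => key2 _ (Or.inr ⟨w, rfl⟩))
    (by simp) (fun a b h1 h2 => ?_) (fun c a h => ?_)
  · rw [map_add, LinearMap.add_apply]; exact add_mem h1 h2
  · rw [map_smul, LinearMap.smul_apply]; exact Submodule.smul_mem _ c h

theorem shuffle_mem_h0 {f g : H K} (hf : f ∈ h0 K) (hg : g ∈ h0 K) : shuffle K f g ∈ h0 K := by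
  refine h0_bilin (fun u v hu hv => ?_) hf hg
  rw [shuffle_word]
  rcases hu with rfl | ⟨u, rfl⟩
  · rw [shuffleWord]; exact hv.word_mem
  rcases hv with rfl | ⟨v, rfl⟩
  · rw [shuffleWord_nil_right]; exact IsAdm.word_mem (Or.inr ⟨u, rfl⟩)
  rw [shuffleWord]
  obtain ⟨f, hf⟩ := shuffleWord_mem_range (K := K) (u ++ [.y]) (.x :: (v ++ [.y]))
    (Or.inr ⟨u, rfl⟩) (Or.inr ⟨.x :: v, rfl⟩) (by simp)
  obtain ⟨g, hg⟩ := shuffleWord_mem_range (K := K) (.x :: (u ++ [.y])) (v ++ [.y])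
    (Or.inr ⟨.x :: u, rfl⟩) (Or.inr ⟨v, rfl⟩) (by simp)
  rw [hf, hg]
  exact add_mem (x_mul_y_mem_h0 f) (x_mul_y_mem_h0 g)

theorem z_mul_mem_h1 (k : ℕ) {f : H K} (hf : f ∈ h1 K) : z K k * f ∈ h1 K := by
  refine h1_induction (p := fun f => z K k * f ∈ h1 K) hf ?_ (fun w => ?_) ?_
    (fun a b h1 h2 => ?_) (fun c a h => ?_)
  · rw [mul_one]; exact mul_y_mem_h1 _
  · have := mul_y_mem_h1 (K := K) (z K k * word K w)
    simpa [word_cons, word_append, word_nil, mul_assoc] using this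
  · rw [mul_zero]; exact zero_mem _
  · rw [mul_add]; exact add_mem h1 h2
  · rw [mul_smul_comm]; exact Submodule.smul_mem _ c h

theorem z_mul_mem_h0 {k : ℕ} (hk : 2 ≤ k) {f : H K} (hf : f ∈ h1 K) : z K k * f ∈ h0 K := by
  obtain ⟨k, rfl⟩ := Nat.exists_eq_add_of_le hk
  have e : z K (2 + k) = letter K .x * z K (1 + k) := by
    rw [z, z, show 2 + k - 1 = k + 1 by omega, show 1 + k - 1 = k by omega, pow_succ', mul_assoc]
  rw [e, mul_assoc]
  refine h1_induction (p := fun f => letter K .x * (z K (1 + k) * f) ∈ h0 K) hf ?_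
    (fun w => ?_) ?_ (fun a b h1 h2 => ?_) (fun c a h => ?_)
  · rw [mul_one]; exact x_mul_y_mem_h0 _
  · have := x_mul_y_mem_h0 (K := K) (z K (1 + k) * word K w)
    simpa [word_cons, word_append, word_nil, mul_assoc] using this
  · rw [mul_zero, mul_zero]; exact zero_mem _
  · rw [mul_add, mul_add]; exact add_mem h1 h2
  · rw [mul_smul_comm, mul_smul_comm]; exact Submodule.smul_mem _ c h

theorem zWord_mem_h1 (l : List ℕ) : zWord K l ∈ h1 K := by
  induction l with
  | nil => exact one_mem_h1
  | cons k l ih =>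
    have : zWord K (k :: l) = z K k * zWord K l := by simp [zWord]
    rw [this]; exact z_mul_mem_h1 k ih

/-- An index is admissible if its entries are positive and the first one (if any) is at least
`2`; the empty index is admissible. -/
def Admissible (k : List ℕ) : Prop := (∀ i ∈ k, 1 ≤ i) ∧ ∀ i ∈ k.head?, 2 ≤ i

theorem Admissible.zWord_mem {k : List ℕ} (hk : Admissible k) : zWord K k ∈ h0 K := by
  cases k with
  | nil => exact one_mem_h0
  | cons k l =>
    have : zWord K (k :: l) = z K k * zWord K l := by simp [zWord]
    rw [this]; exact z_mul_mem_h0 (hk.2 k rfl) (zWord_mem_h1 l)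

theorem stuffleIndex_mem_h1 : ∀ k l : List ℕ, stuffleIndex K k l ∈ h1 K
  | [], l => by rw [stuffleIndex]; exact zWord_mem_h1 l
  | k :: u, [] => by rw [stuffleIndex]; exact zWord_mem_h1 _
  | k :: u, l :: v => by
      rw [stuffleIndex]
      exact add_mem (add_mem (z_mul_mem_h1 k (stuffleIndex_mem_h1 u (l :: v)))
        (z_mul_mem_h1 l (stuffleIndex_mem_h1 (k :: u) v)))
        (z_mul_mem_h1 (k + l) (stuffleIndex_mem_h1 u v))
termination_by k l => k.length + l.length

theorem stuffle_mem_h1 (f g : H K) : stuffle K f g ∈ h1 K := by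
  refine word_induction (p := fun f => stuffle K f g ∈ h1 K) f (fun u => ?_) (by simp)
    (fun a b h1 h2 => ?_) (fun c a h => ?_)
  · refine word_induction (p := fun g => stuffle K (word K u) g ∈ h1 K) g (fun v => ?_) (by simp)
      (fun a b h1 h2 => ?_) (fun c a h => ?_)
    · rw [stuffle_word]; exact stuffleIndex_mem_h1 _ _
    · rw [map_add]; exact add_mem h1 h2
    · rw [map_smul]; exact Submodule.smul_mem _ c h
  · rw [map_add, LinearMap.add_apply]; exact add_mem h1 h2
  · rw [map_smul, LinearMap.smul_apply]; exact Submodule.smul_mem _ c h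

theorem indexAux_pos : ∀ (w : List Letter) (r : ℕ), ∀ i ∈ (indexAux r w).head?, r + 1 ≤ i
  | [], _ => by simp [indexAux]
  | .x :: w, r => by
      intro i hi
      have := indexAux_pos w (r + 1) i (by simpa [indexAux] using hi)
      omega
  | .y :: w, r => by simp [indexAux]

theorem indexAux_entries : ∀ (w : List Letter) (r : ℕ), ∀ i ∈ indexAux r w, 1 ≤ i
  | [], _ => by simp [indexAux]
  | .x :: w, r => by
      intro i hi
      exact indexAux_entries w (r + 1) i (by simpa [indexAux] using hi)
  | .y :: w, r => by
      intro i hi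
      rw [indexAux, List.mem_cons] at hi
      rcases hi with rfl | hi
      · omega
      · exact indexAux_entries w 0 i hi

theorem IsAdm.admissible {w : List Letter} (h : IsAdm w) : Admissible (indexAux 0 w) := by
  rcases h with rfl | ⟨v, rfl⟩
  · simp [indexAux, Admissible]
  · exact ⟨indexAux_entries _ 0, by rw [indexAux]; exact indexAux_pos (v ++ [.y]) 1⟩

theorem stuffle_mem_h0 {f g : H K} (hf : f ∈ h0 K) (hg : g ∈ h0 K) : stuffle K f g ∈ h0 K := by
  refine h0_bilin (fun u v hu hv => ?_) hf hg
  rw [stuffle_word]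
  have hu := hu.admissible
  have hv := hv.admissible
  revert hu hv
  generalize indexAux 0 u = k
  generalize indexAux 0 v = l
  intro hu hv
  cases k with
  | nil => rw [stuffleIndex]; exact hv.zWord_mem
  | cons k u =>
    cases l with
    | nil => rw [stuffleIndex]; exact hu.zWord_mem
    | cons l v =>
      have hk := hu.2 k rfl
      have hl := hv.2 l rfl
      rw [stuffleIndex]
      exact add_mem (add_mem (z_mul_mem_h0 hk (stuffleIndex_mem_h1 _ _))
        (z_mul_mem_h0 hl (stuffleIndex_mem_h1 _ _)))
        (z_mul_mem_h0 (by omega) (stuffleIndex_mem_h1 _ _))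

/-- On the words of `𝔥¹`, `indexAux 0` reads off the index. -/
theorem word_eq_zWord {w : List Letter} (h : EndsY w) : word K w = zWord K (indexAux 0 w) := by
  have key : ∀ (w : List Letter) (r : ℕ), w ≠ [] → EndsY w →
      letter K .x ^ r * word K w = zWord K (indexAux r w) := by
    intro w
    induction w with
    | nil => intro r h; exact absurd rfl h
    | cons a w ih =>
      intro r _ h
      rcases h.tail with ⟨rfl, rfl⟩ | ⟨h1, h2⟩
      · simp [indexAux, zWord, word, z]
      · cases a with
        | x => rw [indexAux, ← ih (r + 1) h1 h2, word_cons, pow_succ, mul_assoc]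
        | y =>
          have := ih 0 h1 h2
          rw [pow_zero, one_mul] at this
          rw [indexAux, word_cons, this]
          simp [zWord, z, mul_assoc]
  by_cases h' : w = []
  · subst h'; rfl
  · have := key w 0 h' h
    rwa [pow_zero, one_mul] at this

theorem S_mem_h0 {f : H K} (hf : f ∈ h0 K) : S K f ∈ h0 K := by
  refine h0_induction (p := fun f => S K f ∈ h0 K) hf ?_ (fun w => ?_) (by simp)
    (fun a b h1 h2 => ?_) (fun c a h => ?_)
  · rw [S_nil]; exact one_mem_h0
  · have e : word K (.x :: (w ++ [.y])) = word K (.x :: w) * letter K .y := by simp [word, mul_assoc]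
    rw [e, S_concat, word_cons, map_mul, mul_assoc]
    have : sigma K (letter K .x) = letter K .x := by simp [sigma, letter]
    rw [this]; exact x_mul_y_mem_h0 _
  · rw [map_add]; exact add_mem h1 h2
  · rw [map_smul]; exact Submodule.smul_mem _ c h

end Lemmas

section Regularization

variable (K : Type*) [Field K]

/-- The shuffle power `y^{⧢ i}`. -/
noncomputable def yPow : ℕ → H K
  | 0 => 1
  | i + 1 => shuffle K (letter K .y) (yPow i)

/-- `∑ᵢ wᵢ ⧢ y^{⧢ i}`, for a finitely supported family of `wᵢ ∈ 𝔥⁰`. -/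
noncomputable def shuffleExpansion (w : ℕ →₀ h0 K) : H K :=
  w.sum fun i u => shuffle K (u : H K) (yPow K i)

variable {K}

/-- The word `y^i`. -/
def yWord (i : ℕ) : List Letter := List.replicate i .y

theorem yWord_succ (i : ℕ) : yWord (i + 1) = .y :: yWord i := rfl

theorem endsY_yWord (i : ℕ) : EndsY (yWord i) := by
  cases i with
  | zero => exact Or.inl rfl
  | succ i => exact Or.inr ⟨List.replicate i .y, List.replicate_succ'⟩

theorem word_yWord (i : ℕ) : word K (yWord i) = letter K .y ^ i := by
  simp [word, yWord]

theorem shuffleWord_y (i : ℕ) :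
    shuffleWord K [.y] (yWord i) = ((i + 1 : ℕ) : K) • word K (yWord (i + 1)) := by
  induction i with
  | zero => simp [yWord, shuffleWord_nil_right]
  | succ i ih =>
    rw [yWord_succ, shuffleWord, ih, shuffleWord, ← yWord_succ, mul_smul_comm, ← word_cons,
      ← yWord_succ, Nat.cast_succ (i + 1), add_smul, one_smul, add_comm]

theorem yPow_eq (i : ℕ) : yPow K i = (i ! : K) • word K (yWord i) := by
  induction i with
  | zero => simp [yPow, yWord, word_nil]
  | succ i ih =>
    have : letter K .y = word K [.y] := by simp [word]
    rw [yPow, ih, map_smul, this, shuffle_word, shuffleWord_y, smul_smul, Nat.factorial_succ,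
      Nat.cast_mul, mul_comm]

theorem shuffleExpansion_eq_lsum (w : ℕ →₀ h0 K) :
    shuffleExpansion K w =
      Finsupp.lsum K (fun i => (shuffle K).flip (yPow K i) ∘ₗ (h0 K).subtype) w := rfl

/-- The subspace of the elements that have an expansion. -/
noncomputable def expandable (K : Type*) [Field K] : Submodule K (H K) :=
  LinearMap.range
    (Finsupp.lsum K (fun i => (shuffle K).flip (yPow K i) ∘ₗ (h0 K).subtype))

theorem shuffle_yPow_mem {h : H K} (hh : h ∈ h0 K) (i : ℕ) :
    shuffle K h (yPow K i) ∈ expandable K :=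
  ⟨Finsupp.single i ⟨h, hh⟩, by simp⟩

theorem shuffleWord_yWord (v : List Letter) (n : ℕ) : ∃ g : ℕ → H K, (∀ i, g i ∈ h0 K) ∧
    shuffleWord K (.x :: (v ++ [.y])) (yWord n) =
      letter K .y ^ n * word K (.x :: (v ++ [.y])) +
        ∑ i ∈ Finset.range n, letter K .y ^ i * g i := by
  induction n with
  | zero => exact ⟨fun _ => 0, fun _ => zero_mem _, by simp [yWord, shuffleWord_nil_right]⟩
  | succ n ih =>
    obtain ⟨g, hg, e⟩ := ih
    obtain ⟨f, hf⟩ := shuffleWord_mem_range (K := K) (v ++ [.y]) (yWord (n + 1))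
      (Or.inr ⟨v, rfl⟩) (endsY_yWord _) (by simp)
    refine ⟨fun i => Nat.casesOn i (letter K .x * (f * letter K .y)) g, fun i => ?_, ?_⟩
    · cases i with
      | zero => exact x_mul_y_mem_h0 f
      | succ i => exact hg i
    · rw [yWord_succ, shuffleWord, ← yWord_succ, hf, e, Finset.sum_range_succ']
      simp only [pow_succ', mul_add, Finset.mul_sum, mul_assoc, pow_zero, one_mul]
      rw [add_comm, add_assoc]
      rfl

theorem y_pow_mul_mem [CharZero K] (n : ℕ) :
    ∀ h ∈ h0 K, letter K .y ^ n * h ∈ expandable K := by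
  induction n using Nat.strong_induction_on with
  | _ n ih =>
    intro h hh
    have key : ∀ f ∈ h0 K, shuffle K f (word K (yWord n)) ∈ expandable K := by
      intro f hf
      have := Submodule.smul_mem _ ((n ! : K)⁻¹) (shuffle_yPow_mem hf n)
      rwa [yPow_eq, map_smul, smul_smul, inv_mul_cancel₀ (by exact_mod_cast n.factorial_ne_zero),
        one_smul] at this
    refine h0_induction (p := fun h => letter K .y ^ n * h ∈ expandable K) hh ?_ (fun v => ?_) ?_
      (fun a b h1 h2 => ?_) (fun c a h => ?_)
    · have := key _ one_mem_h0
      rw [← word_nil, shuffle_word, shuffleWord, word_yWord] at this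
      rwa [mul_one]
    · have h1 := key _ (IsAdm.word_mem (Or.inr ⟨v, rfl⟩))
      rw [shuffle_word] at h1
      obtain ⟨g, hg, e⟩ := shuffleWord_yWord (K := K) v n
      rw [eq_sub_of_add_eq e.symm]
      exact sub_mem h1 (sum_mem fun i hi => ih i (Finset.mem_range.1 hi) _ (hg i))
    · rw [mul_zero]; exact zero_mem _
    · rw [mul_add]; exact add_mem h1 h2
    · rw [mul_smul_comm]; exact Submodule.smul_mem _ c h

theorem endsY_word_eq (w : List Letter) (hw : EndsY w) :
    ∃ n, ∃ h ∈ h0 K, word K w = letter K .y ^ n * h := by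
  induction w with
  | nil => exact ⟨0, 1, one_mem_h0, by simp [word]⟩
  | cons a w ih =>
    cases a with
    | x =>
      rcases hw.tail with h | ⟨h1, h2⟩
      · simp at h
      · obtain ⟨f, hf⟩ := word_mem_range (K := K) h2 h1
        exact ⟨0, word K (.x :: w), by rw [word_cons, hf]; exact x_mul_y_mem_h0 f, by simp⟩
    | y =>
      have hw' : EndsY w := by
        rcases hw.tail with h | h
        · exact Or.inl h.1
        · exact h.2
      obtain ⟨n, h, hh, e⟩ := ih hw'
      exact ⟨n + 1, h, hh, by rw [word_cons, e, pow_succ', mul_assoc]⟩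

theorem h1_le_expandable [CharZero K] : h1 K ≤ expandable K := by
  intro f hf
  have key : ∀ w, EndsY w → word K w ∈ expandable K := by
    intro w hw
    obtain ⟨n, h, hh, e⟩ := endsY_word_eq (K := K) w hw
    rw [e]; exact y_pow_mul_mem n h hh
  exact h1_induction (p := fun f => f ∈ expandable K) hf (key [] (Or.inl rfl))
    (fun w => key _ (Or.inr ⟨w, rfl⟩)) (zero_mem _) (fun _ _ => add_mem)
    (fun c _ => Submodule.smul_mem _ c)

/-- The linear map that removes a first letter `y`, and sends the other words to `0`. -/
noncomputable def strip (K : Type*) [Field K] : H K →ₗ[K] H K :=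
  (wordBasis K).constr K fun w => match w with
    | [] => 0
    | .x :: _ => 0
    | .y :: w => word K w

theorem strip_nil : strip K (word K []) = 0 := by
  rw [← wordBasis_apply, strip, Module.Basis.constr_basis]

theorem strip_x (f : H K) : strip K (letter K .x * f) = 0 := by
  refine word_induction (p := fun f => strip K (letter K .x * f) = 0) f (fun w => ?_) (by simp)
    (fun a b h1 h2 => by rw [mul_add, map_add, h1, h2, add_zero])
    (fun c a h => by rw [mul_smul_comm, map_smul, h, smul_zero])
  rw [← word_cons, ← wordBasis_apply, strip, Module.Basis.constr_basis]

theorem strip_y (f : H K) : strip K (letter K .y * f) = f := by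
  refine word_induction (p := fun f => strip K (letter K .y * f) = f) f (fun w => ?_) (by simp)
    (fun a b h1 h2 => by rw [mul_add, map_add, h1, h2])
    (fun c a h => by rw [mul_smul_comm, map_smul, h])
  rw [← word_cons, ← wordBasis_apply, strip, Module.Basis.constr_basis]

theorem strip_h0 {f : H K} (hf : f ∈ h0 K) : strip K f = 0 := by
  refine h0_induction (p := fun f => strip K f = 0) hf strip_nil (fun w => ?_) (map_zero _)
    (fun a b h1 h2 => by rw [map_add, h1, h2, add_zero])
    (fun c a h => by rw [map_smul, h, smul_zero])
  rw [word_cons, strip_x]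

theorem shuffle_one (f : H K) : shuffle K f 1 = f := by
  refine word_induction (p := fun f => shuffle K f 1 = f) f (fun w => ?_) (by simp)
    (fun a b h1 h2 => by rw [map_add, LinearMap.add_apply, h1, h2])
    (fun c a h => by rw [map_smul, LinearMap.smul_apply, h])
  rw [← word_nil, shuffle_word, shuffleWord_nil_right]

theorem strip_shuffle_yWord {h : H K} (hh : h ∈ h0 K) (n : ℕ) :
    strip K (shuffle K h (word K (yWord (n + 1)))) = shuffle K h (word K (yWord n)) := by
  refine h0_induction (p := fun h => strip K (shuffle K h (word K (yWord (n + 1)))) =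
    shuffle K h (word K (yWord n))) hh ?_ (fun w => ?_) (by simp)
    (fun a b h1 h2 => by simp only [map_add, LinearMap.add_apply, h1, h2])
    (fun c a h => by simp only [map_smul, LinearMap.smul_apply, h])
  · rw [← word_nil, shuffle_word, shuffle_word, shuffleWord, shuffleWord, yWord_succ, word_cons,
      strip_y]
  · rw [shuffle_word, shuffle_word, yWord_succ, shuffleWord, map_add, strip_x, strip_y, zero_add]

theorem shuffleExpansion_injective [CharZero K] (N : ℕ) : ∀ u : ℕ → h0 K,
    ∑ i ∈ Finset.range N, shuffle K (u i : H K) (yPow K i) = 0 → ∀ i < N, u i = 0 := by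
  induction N with
  | zero => intro u _ i hi; omega
  | succ N ih =>
    intro u hu
    have h1 : ∀ i < N, ((i + 1 : ℕ) : K) • u (i + 1) = 0 := by
      refine ih (fun i => ((i + 1 : ℕ) : K) • u (i + 1)) ?_
      have := congrArg (strip K) hu
      rw [Finset.sum_range_succ', map_add, map_zero, map_sum] at this
      have h0 : strip K (shuffle K (u 0 : H K) (yPow K 0)) = 0 := by
        rw [yPow, shuffle_one, strip_h0 (u 0).2]
      rw [h0, add_zero] at this
      rw [← this]
      refine Finset.sum_congr rfl fun i _ => ?_
      rw [yPow_eq, yPow_eq, map_smul, map_smul, map_smul, strip_shuffle_yWord (u (i + 1)).2,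
        Submodule.coe_smul, map_smul, LinearMap.smul_apply, smul_smul, Nat.factorial_succ,
        Nat.cast_mul, mul_comm]
    have h2 : ∀ i < N, u (i + 1) = 0 := fun i hi =>
      (smul_eq_zero.1 (h1 i hi)).resolve_left (by exact_mod_cast Nat.succ_ne_zero i)
    intro i hi
    cases i with
    | succ i => exact h2 i (by omega)
    | zero =>
      rw [Finset.sum_range_succ', Finset.sum_eq_zero, zero_add, yPow, shuffle_one] at hu
      · exact Subtype.ext hu
      · intro i hi'
        rw [h2 i (Finset.mem_range.1 hi')]
        simp

/-- Every element of `𝔥¹` is `∑ᵢ wᵢ ⧢ y^{⧢ i}` for exactly one family of `wᵢ ∈ 𝔥⁰`, that is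
`𝔥¹_⧢ = 𝔥⁰_⧢[y]`. -/
theorem existsUnique_shuffleExpansion [CharZero K] {f : H K} (hf : f ∈ h1 K) :
    ∃! w : ℕ →₀ h0 K, f = shuffleExpansion K w := by
  obtain ⟨w, hw⟩ := h1_le_expandable hf
  refine ⟨w, hw.symm, fun v hv => ?_⟩
  have hv' : f = shuffleExpansion K v := hv
  rw [shuffleExpansion_eq_lsum, ← hw, ← sub_eq_zero, ← map_sub, ← shuffleExpansion_eq_lsum] at hv'
  have h0 : shuffleExpansion K (w - v) = 0 := hv'
  refine (sub_eq_zero.1 ?_).symm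
  generalize w - v = d at h0
  ext1 i
  have h1 : ∑ i ∈ Finset.range (d.support.sup id + 1), shuffle K (d i : H K) (yPow K i) = 0 := by
    rw [← h0, shuffleExpansion, Finsupp.sum]
    symm
    refine Finset.sum_subset (fun i hi => ?_) (fun i _ hi => ?_)
    · exact Finset.mem_range.2 (Nat.lt_succ_of_le (Finset.le_sup (f := id) hi))
    · rw [Finsupp.notMem_support_iff.1 hi]; simp
  by_cases hi : i ∈ d.support
  · exact shuffleExpansion_injective _ _ h1 i
      (Nat.lt_succ_of_le (Finset.le_sup (f := id) hi))
  · exact Finsupp.notMem_support_iff.1 hi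

/-- The regularization map `reg_⧢ : 𝔥¹ → 𝔥⁰`, which sends `∑ᵢ wᵢ ⧢ y^{⧢ i}`, `wᵢ ∈ 𝔥⁰`,
to `w₀`. -/
noncomputable def regShuffle [CharZero K] (f : h1 K) : h0 K :=
  (existsUnique_shuffleExpansion f.2).choose 0

end Regularization

section Zeta

variable {K : Type*} [Field K] {R : Type*} [CommRing R] [Algebra K R]

/-- The pair `(R, Z)` satisfies the (finite) double shuffle relations, with `Z(1) = 1`. -/
structure DoubleShuffle (Z : h0 K →ₗ[K] R) : Prop where
  map_one : Z ⟨1, one_mem_h0⟩ = 1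
  map_shuffle : ∀ u v : h0 K,
    Z ⟨shuffle K u v, shuffle_mem_h0 u.2 v.2⟩ = Z u * Z v
  map_stuffle : ∀ u v : h0 K,
    Z ⟨stuffle K u v, stuffle_mem_h0 u.2 v.2⟩ = Z u * Z v

/-- The pair `(R, Z)` satisfies the regularized double shuffle relations: the double shuffle
relations, and `Z(reg_⧢(w₁ ⧢ w₀ - w₁ ∗ w₀)) = 0` for all `w₁ ∈ 𝔥¹` and `w₀ ∈ 𝔥⁰`. -/
structure RegularizedDoubleShuffle [CharZero K] (Z : h0 K →ₗ[K] R) : Prop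
    extends DoubleShuffle Z where
  map_reg : ∀ (w₁ : h1 K) (w₀ : h0 K),
    Z (regShuffle ⟨shuffle K w₁ w₀ - stuffle K w₁ w₀,
      sub_mem (shuffle_mem_h1 w₁.2 (h0_le_h1 w₀.2)) (stuffle_mem_h1 _ _)⟩) = 0

/-- `Z^⋆ = Z ∘ S`. -/
noncomputable def star (Z : h0 K →ₗ[K] R) : h0 K →ₗ[K] R :=
  Z ∘ₗ (S K).restrict fun _ => S_mem_h0

/-- `ζ_R(k₁, …, kₙ) = Z(z_{k₁} ⋯ z_{kₙ})`. -/
noncomputable def zeta (Z : h0 K →ₗ[K] R) (k : List ℕ) (hk : Admissible k) : R :=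
  Z ⟨zWord K k, hk.zWord_mem⟩

/-- `ζ_R^⋆(k₁, …, kₙ) = Z^⋆(z_{k₁} ⋯ z_{kₙ})`. -/
noncomputable def zetaStar (Z : h0 K →ₗ[K] R) (k : List ℕ) (hk : Admissible k) : R :=
  zeta (star Z) k hk

theorem admissible_two : Admissible [2] := by simp [Admissible]

theorem admissible_map {a : ℕ} (ha : 2 ≤ a) {k : ℕ} (c : Composition k) :
    Admissible (c.blocks.map (a * ·)) := by
  have h : ∀ i ∈ c.blocks.map (a * ·), 2 ≤ i := by
    intro i hi
    obtain ⟨j, hj, rfl⟩ := List.mem_map.1 hi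
    exact ha.trans (Nat.le_mul_of_pos_right a (c.blocks_pos hj))
  exact ⟨fun i hi => one_le_two.trans (h i hi), fun i hi => h i (List.mem_of_mem_head? hi)⟩

/-- The restricted sum `∑ ζ_R(a k₁, …, a kₙ)` over all `k₁ + ⋯ + kₙ = k` with `kᵢ ≥ 1`. -/
noncomputable def restrictedSum (Z : h0 K →ₗ[K] R) {a : ℕ} (ha : 2 ≤ a) (k n : ℕ) : R :=
  ∑ c : Composition k with c.length = n, zeta Z (c.blocks.map (a * ·)) (admissible_map ha c)

/-- The restricted sum `∑ ζ_R^⋆(a k₁, …, a kₙ)` over all `k₁ + ⋯ + kₙ = k` with `kᵢ ≥ 1`. -/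
noncomputable def restrictedSumStar (Z : h0 K →ₗ[K] R) {a : ℕ} (ha : 2 ≤ a) (k n : ℕ) : R :=
  ∑ c : Composition k with c.length = n, zetaStar Z (c.blocks.map (a * ·)) (admissible_map ha c)

end Zeta

/-- `ρ_m = e^{π √-1 / m}`. -/
noncomputable def rho (m : ℕ) : ℂ := Complex.exp (Real.pi * Complex.I / m)

/-- The inner sum of the restricted sum formulas,
`∑ [∏_{i < m} (2 - 4^{nᵢ}) B_{2nᵢ} / ((2nᵢ)! (2lᵢ + 1)!)] ρ_m^{∑ 2i(nᵢ + lᵢ)}`, over all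
`n₀ + ⋯ + n_{m-1} = mp` and `l₀ + ⋯ + l_{m-1} = mq` with `nᵢ, lᵢ ≥ 0`. -/
noncomputable def innerSum (m p q : ℕ) : ℂ :=
  ∑ ν ∈ Finset.piAntidiag (Finset.univ : Finset (Fin m)) (m * p),
    ∑ l ∈ Finset.piAntidiag (Finset.univ : Finset (Fin m)) (m * q),
      (∏ i, (2 - 4 ^ ν i) * (bernoulli (2 * ν i) : ℂ) / ((2 * ν i)! * (2 * l i + 1)!)) *
        rho m ^ (∑ i : Fin m, 2 * (i : ℕ) * (ν i + l i))

end MZV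

namespace MZV

open Finset.HasAntidiagonal (antidiagonal mem_antidiagonal)

/-! ### Recursion of the stuffle product on `h1`. -/

section Stuffle

variable {K : Type*} [Field K]

/-! Write a = 2m. For a series θ without constant term, let W(θ) be the generating series, over all
compositions c, of the words z_{a c₁} ⋯ z_{a cₙ} with weight ∏ θ_{cᵢ}. The stuffle recursion gives
W(θ) ∗ W(η) = W(θ + η + θη), so W(θ) depends multiplicatively on 1 + θ (`stuffleConv_wordSeries`).
Take 1 + θ = (1 - αt)/(1 - βt). For (α, β) = (1 - y, 1) every block has weight y, so the powers of y
record the depth and W collects the restricted sums. For (α, β) = (1, 1 + y) it collects the star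
sums, because S merges adjacent blocks (`sum_S_zWord`). Factoring into 1 - αt and 1/(1 - βt) and
comparing powers of y turns both restricted sums into convolutions of Eᵢ = (-1)^i ζ_R(a, …, a) and
Hᵢ = ζ_R^⋆(a, …, a).

The series E and H are mutually inverse. Depth one of the same formula is Newton's identity: tE' =
-PE and tH' = PH with P = ∑ ζ_R(ak) tᵏ. Hence only the values ζ_R(2n) matter. In depth two, shuffle,
stuffle and one regularized relation give 2 ∑ ζ_R(2i) ζ_R(2j) = (2n + 1) ζ_R(2n), over i + j = n
with i, j ≥ 1 and n ≥ 2 (`RegularizedDoubleShuffle.sum_even_zeta`). This is, up to sign, the Riccati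
recursion for the logarithmic derivative of sinh z / z in the variable z² (`sinhLog_convolution`),
so ζ_R(2n) is a rational multiple of (λ²/4)ⁿ (`zeta_even_eq`).

It remains to solve Newton's recursion whose data are every m-th coefficient of that logarithmic
derivative. Products over the m-th roots of unity of rescaled copies of sinh z / z, or of z / sinh
z, satisfy the same recursion at multiples of m (`coeff_prod_rescale`). Their expansions are the
factors of D_{m,p,q}. Since the recursion is rational, so are the constants. -/

theorem zWord_cons (k : ℕ) (l : List ℕ) : zWord K (k :: l) = z K k * zWord K l := by
  simp [zWord]

theorem zWord_nil : zWord K [] = 1 := rfl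

theorem indexAux_replicate_append (n r : ℕ) (w : List Letter) :
    indexAux r (List.replicate n .x ++ .y :: w) = (r + n + 1) :: indexAux 0 w := by
  induction n generalizing r with
  | zero => simp [indexAux]
  | succ n ih =>
    rw [List.replicate_succ, List.cons_append, indexAux, ih]
    congr 1
    omega

theorem exists_word_of_index (l : List ℕ) (hl : ∀ i ∈ l, 1 ≤ i) :
    ∃ w, EndsY w ∧ indexAux 0 w = l := by
  induction l with
  | nil => exact ⟨[], Or.inl rfl, rfl⟩
  | cons k l ih =>
    obtain ⟨w, hw, e⟩ := ih fun i hi => hl i (List.mem_cons_of_mem _ hi)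
    have hk := hl k List.mem_cons_self
    refine ⟨List.replicate (k - 1) .x ++ .y :: w, Or.inr ?_, ?_⟩
    · rcases hw with rfl | ⟨v, rfl⟩
      · exact ⟨_, rfl⟩
      · exact ⟨List.replicate (k - 1) .x ++ .y :: v, by simp⟩
    · rw [indexAux_replicate_append, e]
      congr 1
      omega

/-- `stuffle` is defined on words in x and y through `indexAux`. Every positive index is realised by
such a word, so the recursion of `stuffleIndex` becomes available for products of the z_k. -/
theorem stuffle_zWord {k l : List ℕ} (hk : ∀ i ∈ k, 1 ≤ i) (hl : ∀ i ∈ l, 1 ≤ i) :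
    stuffle K (zWord K k) (zWord K l) = stuffleIndex K k l := by
  obtain ⟨u, hu, rfl⟩ := exists_word_of_index k hk
  obtain ⟨v, hv, rfl⟩ := exists_word_of_index l hl
  rw [← word_eq_zWord hu, ← word_eq_zWord hv, stuffle_word]

theorem h1_zWord_induction {p : H K → Prop} {f : H K} (hf : f ∈ h1 K)
    (hw : ∀ l : List ℕ, (∀ i ∈ l, 1 ≤ i) → p (zWord K l))
    (hz : p 0) (ha : ∀ a b, p a → p b → p (a + b)) (hs : ∀ (c : K) a, p a → p (c • a)) : p f := by
  refine h1_induction hf (hw [] (by simp)) (fun w => ?_) hz ha hs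
  rw [word_eq_zWord (Or.inr ⟨w, rfl⟩)]
  exact hw _ (indexAux_entries _ 0)

theorem one_stuffle {f : H K} (hf : f ∈ h1 K) : stuffle K 1 f = f := by
  refine h1_zWord_induction (p := fun f => stuffle K 1 f = f) hf (fun l hl => ?_) (by simp)
    (fun a b h1 h2 => by rw [map_add, h1, h2]) (fun c a h => by rw [map_smul, h])
  rw [← zWord_nil, stuffle_zWord (by simp) hl, stuffleIndex]

theorem stuffle_one {f : H K} (hf : f ∈ h1 K) : stuffle K f 1 = f := by
  refine h1_zWord_induction (p := fun f => stuffle K f 1 = f) hf (fun l hl => ?_) (by simp)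
    (fun a b h1 h2 => by rw [map_add, LinearMap.add_apply, h1, h2])
    (fun c a h => by rw [map_smul, LinearMap.smul_apply, h])
  rw [← zWord_nil, stuffle_zWord hl (by simp)]
  cases l <;> rw [stuffleIndex]

/-- The recursion of the stuffle product, for arbitrary elements of `𝔥¹`. -/
theorem stuffle_z_mul {k l : ℕ} (hk : 1 ≤ k) (hl : 1 ≤ l) {f g : H K}
    (hf : f ∈ h1 K) (hg : g ∈ h1 K) :
    stuffle K (z K k * f) (z K l * g) =
      z K k * stuffle K f (z K l * g) + z K l * stuffle K (z K k * f) g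
        + z K (k + l) * stuffle K f g := by
  refine h1_zWord_induction (p := fun f => stuffle K (z K k * f) (z K l * g) =
      z K k * stuffle K f (z K l * g) + z K l * stuffle K (z K k * f) g
        + z K (k + l) * stuffle K f g) hf (fun u hu => ?_) (by simp)
    (fun a b h1 h2 => ?_) (fun c a h => ?_)
  · refine h1_zWord_induction (p := fun g => stuffle K (z K k * zWord K u) (z K l * g) =
      z K k * stuffle K (zWord K u) (z K l * g) + z K l * stuffle K (z K k * zWord K u) g
        + z K (k + l) * stuffle K (zWord K u) g) hg (fun v hv => ?_) (by simp)
      (fun a b h1 h2 => ?_) (fun c a h => ?_)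
    · have hu' : ∀ i ∈ k :: u, 1 ≤ i := by simpa [hk] using hu
      have hv' : ∀ i ∈ l :: v, 1 ≤ i := by simpa [hl] using hv
      rw [← zWord_cons, ← zWord_cons, stuffle_zWord hu' hv', stuffle_zWord hu hv',
        stuffle_zWord hu' hv, stuffle_zWord hu hv, stuffleIndex]
    · simp only [mul_add, map_add, h1, h2]; abel
    · simp only [mul_smul_comm, map_smul, h, smul_add]
  · simp only [mul_add, map_add, LinearMap.add_apply, h1, h2]; abel
  · simp only [mul_smul_comm, map_smul, LinearMap.smul_apply, h, smul_add]

end Stuffle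

/-! ### Splitting off the first block of a composition. -/

section Compositions

theorem sum_composition_succ {M : Type*} [AddCommMonoid M] (f : List ℕ → M) (k : ℕ) :
    ∑ c : Composition (k + 1), f c.blocks =
      ∑ q ∈ antidiagonal k, ∑ c : Composition q.2, f ((q.1 + 1) :: c.blocks) := by
  rw [Finset.Nat.sum_antidiagonal_eq_sum_range_succ
    (fun i j => ∑ c : Composition j, f ((i + 1) :: c.blocks)), Finset.sum_range, ← Fintype.sum_sigma'
      (fun (i : Fin k.succ) (c : Composition (k - i)) => f ((i.1 + 1) :: c.blocks))]
  symm
  refine Fintype.sum_bijective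
    (fun s : (Σ i : Fin k.succ, Composition (k - i)) => (⟨(s.1.1 + 1) :: s.2.blocks, ?_, ?_⟩ :
      Composition (k + 1))) ⟨?_, ?_⟩ _ _ (fun s => rfl)
  · intro i hi
    rcases List.mem_cons.1 hi with rfl | hi
    · exact Nat.succ_pos _
    · exact s.2.blocks_pos hi
  · have := s.1.2
    rw [List.sum_cons, s.2.blocks_sum]
    omega
  · rintro ⟨i, c⟩ ⟨j, d⟩ h
    simp only [Composition.mk.injEq, List.cons.injEq, add_left_inj] at h
    obtain rfl : i = j := Fin.ext h.1
    obtain rfl : c = d := Composition.ext h.2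
    rfl
  · rintro ⟨b, hb, hs⟩
    cases b with
    | nil => simp at hs
    | cons i l =>
      have hi : 0 < i := hb List.mem_cons_self
      rw [List.sum_cons] at hs
      refine ⟨⟨⟨i - 1, by omega⟩, ⟨l, fun h => hb (List.mem_cons_of_mem _ h), ?_⟩⟩, ?_⟩
      · simp only; omega
      · simp only [Composition.mk.injEq, List.cons.injEq, and_true]
        omega

theorem sum_composition_zero {M : Type*} [AddCommMonoid M] (f : List ℕ → M) :
    ∑ c : Composition 0, f c.blocks = f [] := by
  have h : ∀ c : Composition 0, c.blocks = [] := fun c => c.blocks_eq_nil.2 rfl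
  simp [h, composition_card]

end Compositions


/-! ### Reindexings of fourfold convolutions, one for each term of the stuffle recursion. -/

section FourfoldConvolution

variable {M : Type*} [AddCommMonoid M] (g : ℕ → ℕ → ℕ → ℕ → M) (k : ℕ)

theorem sum_antidiagonal_extract_fst :
    ∑ q ∈ antidiagonal k, ∑ a ∈ antidiagonal q.1, ∑ b ∈ antidiagonal q.2, g a.1 a.2 b.1 b.2 =
      ∑ q ∈ antidiagonal k, ∑ a ∈ antidiagonal q.2, ∑ b ∈ antidiagonal a.2, g q.1 a.1 b.1 b.2 := by
  simp only [Finset.sum_sigma']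
  refine Finset.sum_nbij' (fun s => ⟨(s.2.1.1, s.2.1.2 + s.1.2), (s.2.1.2, s.1.2), s.2.2⟩)
    (fun s => ⟨(s.1.1 + s.2.1.1, s.2.1.2), (s.1.1, s.2.1.1), s.2.2⟩) ?_ ?_ ?_ ?_ ?_
  all_goals
    rintro ⟨⟨a, b⟩, ⟨⟨c, d⟩, ⟨e, f⟩⟩⟩ h
    simp only [Finset.mem_sigma, mem_antidiagonal] at h ⊢
  · obtain ⟨h1, h2, h3⟩ := h
    refine ⟨?_, ?_, ?_⟩ <;> first | trivial | omega
  · obtain ⟨h1, h2, h3⟩ := h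
    refine ⟨?_, ?_, ?_⟩ <;> first | trivial | omega
  · obtain ⟨h1, h2, h3⟩ := h
    subst h2 h3 h1; rfl
  · obtain ⟨h1, h2, h3⟩ := h
    subst h2 h3 h1; rfl

theorem sum_antidiagonal_extract_snd :
    ∑ q ∈ antidiagonal k, ∑ a ∈ antidiagonal q.1, ∑ b ∈ antidiagonal q.2, g a.1 a.2 b.1 b.2 =
      ∑ q ∈ antidiagonal k, ∑ a ∈ antidiagonal q.2, ∑ b ∈ antidiagonal a.1, g b.1 b.2 q.1 a.2 := by
  simp only [Finset.sum_sigma']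
  refine Finset.sum_nbij' (fun s => ⟨(s.2.2.1, s.1.1 + s.2.2.2), (s.1.1, s.2.2.2), s.2.1⟩)
    (fun s => ⟨(s.2.1.1, s.1.1 + s.2.1.2), s.2.2, (s.1.1, s.2.1.2)⟩) ?_ ?_ ?_ ?_ ?_
  all_goals
    rintro ⟨⟨a, b⟩, ⟨⟨c, d⟩, ⟨e, f⟩⟩⟩ h
    simp only [Finset.mem_sigma, mem_antidiagonal] at h ⊢
  · obtain ⟨h1, h2, h3⟩ := h
    refine ⟨?_, ?_, ?_⟩ <;> first | trivial | omega
  · obtain ⟨h1, h2, h3⟩ := h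
    refine ⟨?_, ?_, ?_⟩ <;> first | trivial | omega
  · obtain ⟨h1, h2, h3⟩ := h
    subst h2 h3 h1; rfl
  · obtain ⟨h1, h2, h3⟩ := h
    subst h2 h3 h1; rfl

theorem sum_antidiagonal_extract_add :
    ∑ q ∈ antidiagonal k, ∑ a ∈ antidiagonal q.1, ∑ b ∈ antidiagonal q.2, g a.1 a.2 b.1 b.2 =
      ∑ q ∈ antidiagonal k, ∑ a ∈ antidiagonal q.1, ∑ b ∈ antidiagonal q.2, g a.1 b.1 a.2 b.2 := by
  simp only [Finset.sum_sigma']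
  refine Finset.sum_nbij'
    (fun s => ⟨(s.2.1.1 + s.2.2.1, s.2.1.2 + s.2.2.2), (s.2.1.1, s.2.2.1), (s.2.1.2, s.2.2.2)⟩)
    (fun s => ⟨(s.2.1.1 + s.2.2.1, s.2.1.2 + s.2.2.2), (s.2.1.1, s.2.2.1), (s.2.1.2, s.2.2.2)⟩)
    ?_ ?_ ?_ ?_ ?_
  all_goals
    rintro ⟨⟨a, b⟩, ⟨⟨c, d⟩, ⟨e, f⟩⟩⟩ h
    simp only [Finset.mem_sigma, mem_antidiagonal] at h ⊢
  · obtain ⟨h1, h2, h3⟩ := h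
    refine ⟨?_, ?_, ?_⟩ <;> first | trivial | omega
  · obtain ⟨h1, h2, h3⟩ := h
    refine ⟨?_, ?_, ?_⟩ <;> first | trivial | omega
  · obtain ⟨h1, h2, h3⟩ := h
    subst h2 h3 h1; rfl
  · obtain ⟨h1, h2, h3⟩ := h
    subst h2 h3 h1; rfl

end FourfoldConvolution

/-! ### Weighted sums of words and their stuffle products. -/

section WordSeries

variable {K : Type*} [Field K]

open PowerSeries

/-- The operator `A ↦ (∑ₚ θₚ z_{ap} tᵖ) A` on the series `A` with coefficients in `𝔥`. -/
noncomputable def zOp (a : ℕ) (θ : K⟦X⟧) (A : ℕ → H K) (k : ℕ) : H K :=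
  ∑ q ∈ antidiagonal k, coeff q.1 θ • (z K (a * q.1) * A q.2)

/-- The stuffle product of two series with coefficients in `𝔥`. -/
noncomputable def stuffleConv (A B : ℕ → H K) (k : ℕ) : H K :=
  ∑ q ∈ antidiagonal k, stuffle K (A q.1) (B q.2)

/-- The weighted sum `∑ θ_{c₁} ⋯ θ_{cₙ} z_{a c₁} ⋯ z_{a cₙ}` over the compositions of `k`. -/
noncomputable def wordSeries (a : ℕ) (θ : K⟦X⟧) (k : ℕ) : H K :=
  ∑ c : Composition k, (c.blocks.map fun i => coeff i θ).prod • zWord K (c.blocks.map (a * ·))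

/-- The unit series. -/
noncomputable def unitSeries (K : Type*) [Field K] (k : ℕ) : H K := if k = 0 then 1 else 0

theorem wordSeries_zero (a : ℕ) (θ : K⟦X⟧) : wordSeries a θ 0 = 1 := by
  rw [wordSeries, sum_composition_zero
    (fun l => (l.map fun i => coeff i θ).prod • zWord K (l.map (a * ·)))]
  simp [zWord_nil]

theorem wordSeries_succ (a : ℕ) (θ : K⟦X⟧) (k : ℕ) :
    wordSeries a θ (k + 1) = ∑ q ∈ antidiagonal k,
      coeff (q.1 + 1) θ • (z K (a * (q.1 + 1)) * wordSeries a θ q.2) := by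
  rw [wordSeries, sum_composition_succ
    (fun l => (l.map fun i => coeff i θ).prod • zWord K (l.map (a * ·)))]
  refine Finset.sum_congr rfl fun q _ => ?_
  rw [wordSeries, Finset.mul_sum, Finset.smul_sum]
  refine Finset.sum_congr rfl fun c _ => ?_
  rw [List.map_cons, List.map_cons, List.prod_cons, zWord_cons, mul_smul_comm, smul_smul]

theorem zOp_zero {a : ℕ} {θ : K⟦X⟧} (hθ : constantCoeff θ = 0) (A : ℕ → H K) :
    zOp a θ A 0 = 0 := by
  simp [zOp, hθ]

theorem zOp_succ {a : ℕ} {θ : K⟦X⟧} (hθ : constantCoeff θ = 0) (A : ℕ → H K) (k : ℕ) :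
    zOp a θ A (k + 1) =
      ∑ q ∈ antidiagonal k, coeff (q.1 + 1) θ • (z K (a * (q.1 + 1)) * A q.2) := by
  simp [zOp, Finset.Nat.antidiagonal_succ, hθ]

/-- Splitting off the first block exhibits the series as a fixed point, the analogue of W = 1/(1 - ∑
θₚ z_{ap} tᵖ). -/
theorem wordSeries_eq {a : ℕ} {θ : K⟦X⟧} (hθ : constantCoeff θ = 0) :
    wordSeries a θ = unitSeries K + zOp a θ (wordSeries a θ) := by
  funext k
  cases k with
  | zero => simp [wordSeries_zero, zOp_zero hθ, unitSeries]
  | succ k => simp [wordSeries_succ, zOp_succ hθ, unitSeries]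

/-- The fixed point is unique: as θ has no constant term, the k-th coefficient of `zOp a θ A`
involves A only below k. -/
theorem eq_wordSeries {a : ℕ} {θ : K⟦X⟧} (hθ : constantCoeff θ = 0) {A : ℕ → H K}
    (hA : A = unitSeries K + zOp a θ A) : A = wordSeries a θ := by
  funext k
  induction k using Nat.strong_induction_on with
  | _ k ih =>
    rw [hA, wordSeries_eq hθ, Pi.add_apply, Pi.add_apply]
    congr 1
    cases k with
    | zero => rw [zOp_zero hθ, zOp_zero hθ]
    | succ k =>
      rw [zOp_succ hθ, zOp_succ hθ]
      refine Finset.sum_congr rfl fun q hq => ?_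
      rw [ih q.2 (by have := mem_antidiagonal.1 hq; omega)]

theorem wordSeries_mem_h1 (a : ℕ) (θ : K⟦X⟧) (k : ℕ) : wordSeries a θ k ∈ h1 K :=
  sum_mem fun _ _ => Submodule.smul_mem _ _ (zWord_mem_h1 _)

theorem wordSeries_mem_h0 {a : ℕ} (ha : 2 ≤ a) (θ : K⟦X⟧) (k : ℕ) : wordSeries a θ k ∈ h0 K :=
  sum_mem fun c _ => Submodule.smul_mem _ _ (admissible_map ha c).zWord_mem

theorem zOp_add_left (a : ℕ) (θ η : K⟦X⟧) (A : ℕ → H K) :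
    zOp a (θ + η) A = zOp a θ A + zOp a η A := by
  funext k
  simp [zOp, add_smul, Finset.sum_add_distrib]

theorem zOp_add_right (a : ℕ) (θ : K⟦X⟧) (A B : ℕ → H K) :
    zOp a θ (A + B) = zOp a θ A + zOp a θ B := by
  funext k
  simp [zOp, mul_add, Finset.sum_add_distrib]

theorem stuffleConv_add_left (A B C : ℕ → H K) :
    stuffleConv (A + B) C = stuffleConv A C + stuffleConv B C := by
  funext k
  simp [stuffleConv, Finset.sum_add_distrib]

theorem stuffleConv_add_right (A B C : ℕ → H K) :
    stuffleConv A (B + C) = stuffleConv A B + stuffleConv A C := by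
  funext k
  simp [stuffleConv, Finset.sum_add_distrib]

theorem zOp_mem_h1 (a : ℕ) (θ : K⟦X⟧) {A : ℕ → H K} (hA : ∀ k, A k ∈ h1 K) (k : ℕ) :
    zOp a θ A k ∈ h1 K :=
  sum_mem fun _ _ => Submodule.smul_mem _ _ (z_mul_mem_h1 _ (hA _))

theorem unit_stuffleConv {A : ℕ → H K} (hA : ∀ k, A k ∈ h1 K) :
    stuffleConv (unitSeries K) A = A := by
  funext k
  rw [stuffleConv, Finset.sum_eq_single (0, k)]
  · simp [unitSeries, one_stuffle (hA k)]
  · rintro ⟨i, j⟩ h h'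
    have : i ≠ 0 := by
      rintro rfl
      simp at h
      simp [h] at h'
    simp [unitSeries, this]
  · simp

theorem stuffleConv_unit {A : ℕ → H K} (hA : ∀ k, A k ∈ h1 K) :
    stuffleConv A (unitSeries K) = A := by
  funext k
  rw [stuffleConv, Finset.sum_eq_single (k, 0)]
  · simp [unitSeries, stuffle_one (hA k)]
  · rintro ⟨i, j⟩ h h'
    have : j ≠ 0 := by
      rintro rfl
      simp at h
      simp [h] at h'
    simp [unitSeries, this]
  · simp

theorem stuffleConv_zOp_zOp {a : ℕ} (ha : 1 ≤ a) {θ η : K⟦X⟧} (hθ : constantCoeff θ = 0)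
    (hη : constantCoeff η = 0) {A B : ℕ → H K} (hA : ∀ k, A k ∈ h1 K) (hB : ∀ k, B k ∈ h1 K) :
    stuffleConv (zOp a θ A) (zOp a η B) =
      zOp a θ (stuffleConv A (zOp a η B)) + zOp a η (stuffleConv (zOp a θ A) B) +
        zOp a (θ * η) (stuffleConv A B) := by
  funext k
  have key : ∀ p i q j : ℕ,
      (coeff p θ * coeff q η) • stuffle K (z K (a * p) * A i) (z K (a * q) * B j) =
        coeff p θ • (z K (a * p) * (coeff q η • stuffle K (A i) (z K (a * q) * B j))) +
        coeff q η • (z K (a * q) * (coeff p θ • stuffle K (z K (a * p) * A i) (B j))) +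
        (coeff p θ * coeff q η) • (z K (a * (p + q)) * stuffle K (A i) (B j)) := by
    intro p i q j
    -- By truncated subtraction `z K 0` is the letter y, for which the stuffle recursion would be
    -- false; the vanishing constant terms remove these cases.
    rcases Nat.eq_zero_or_pos p with rfl | hp
    · simp [hθ]
    rcases Nat.eq_zero_or_pos q with rfl | hq
    · simp [hη]
    rw [stuffle_z_mul (Nat.mul_pos ha hp) (Nat.mul_pos ha hq) (hA i) (hB j), smul_add, smul_add,
      mul_smul_comm, mul_smul_comm, smul_smul, smul_smul, mul_add, mul_comm (coeff q η)]
  have e0 : stuffleConv (zOp a θ A) (zOp a η B) k =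
      ∑ q ∈ antidiagonal k, ∑ s ∈ antidiagonal q.1, ∑ t ∈ antidiagonal q.2,
        (coeff s.1 θ * coeff t.1 η) •
          stuffle K (z K (a * s.1) * A s.2) (z K (a * t.1) * B t.2) := by
    simp only [stuffleConv, zOp, map_sum, LinearMap.sum_apply, map_smul, LinearMap.smul_apply,
      Finset.smul_sum, smul_smul]
    refine Finset.sum_congr rfl fun q _ => ?_
    rw [Finset.sum_comm]
    exact Finset.sum_congr rfl fun s _ => Finset.sum_congr rfl fun t _ => by rw [mul_comm]
  rw [e0]
  simp only [key, Finset.sum_add_distrib, Pi.add_apply]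
  congr 1
  · congr 1
    · rw [sum_antidiagonal_extract_fst (fun p i q j =>
        coeff p θ • (z K (a * p) * (coeff q η • stuffle K (A i) (z K (a * q) * B j))))]
      simp only [stuffleConv, zOp, map_sum, map_smul, Finset.smul_sum, Finset.mul_sum]
    · rw [sum_antidiagonal_extract_snd (fun p i q j =>
        coeff q η • (z K (a * q) * (coeff p θ • stuffle K (z K (a * p) * A i) (B j))))]
      simp only [stuffleConv, zOp, map_sum, map_smul, Finset.smul_sum, Finset.mul_sum,
        LinearMap.sum_apply, LinearMap.smul_apply]
  · rw [sum_antidiagonal_extract_add (fun p i q j =>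
      (coeff p θ * coeff q η) • (z K (a * (p + q)) * stuffle K (A i) (B j)))]
    simp only [stuffleConv, zOp, coeff_mul, Finset.sum_smul, Finset.mul_sum]
    refine Finset.sum_congr rfl fun q _ => Finset.sum_congr rfl fun s hs => ?_
    rw [mem_antidiagonal.1 hs, Finset.smul_sum]

/-- The stuffle product of two weighted sums over the compositions corresponds to the product of
the series of the weights. -/
theorem stuffleConv_wordSeries {a : ℕ} (ha : 1 ≤ a) {θ η : K⟦X⟧} (hθ : constantCoeff θ = 0)
    (hη : constantCoeff η = 0) :
    stuffleConv (wordSeries a θ) (wordSeries a η) = wordSeries a (θ + η + θ * η) := by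
  -- By uniqueness it suffices that the product solves the fixed-point equation for θ + η + θη. Both
  -- factors are expanded once as 1 plus a `zOp`, and the three terms of the stuffle recursion
  -- supply the weights θ, η and θη.
  refine eq_wordSeries (by simp [hθ, hη]) ?_
  set A := wordSeries a θ with hA
  set B := wordSeries a η with hB
  have mA : ∀ k, A k ∈ h1 K := wordSeries_mem_h1 a θ
  have mB : ∀ k, B k ∈ h1 K := wordSeries_mem_h1 a η
  have eA : A = unitSeries K + zOp a θ A := wordSeries_eq hθ
  have eB : B = unitSeries K + zOp a η B := wordSeries_eq hη
  have mZ := zOp_mem_h1 a θ mA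
  have mZ' := zOp_mem_h1 a η mB
  have u : stuffleConv (unitSeries K) (unitSeries K) = unitSeries K := unit_stuffleConv fun k => by
    rw [unitSeries]; split_ifs
    · exact one_mem_h1
    · exact zero_mem _
  have h1 : zOp a θ (stuffleConv A B) = zOp a θ A + zOp a θ (stuffleConv A (zOp a η B)) := by
    rw [← zOp_add_right]
    conv_lhs => rw [eB, stuffleConv_add_right, stuffleConv_unit mA]
  have h2 : zOp a η (stuffleConv A B) = zOp a η B + zOp a η (stuffleConv (zOp a θ A) B) := by
    rw [← zOp_add_right]
    conv_lhs => rw [eA, stuffleConv_add_left, unit_stuffleConv mB]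
  rw [zOp_add_left, zOp_add_left, h1, h2]
  conv_lhs =>
    rw [eA, eB, stuffleConv_add_left, stuffleConv_add_right, stuffleConv_add_right, u,
      unit_stuffleConv mZ', stuffleConv_unit mZ, stuffleConv_zOp_zOp ha hθ hη mA mB]
  abel

end WordSeries

/-! ### The weights (1 - αt)/(1 - βt) - 1. -/

section HomographicWeight

variable {K : Type*} [Field K]

open PowerSeries

/-- The series `(1 - α t) / (1 - β t) - 1`. -/
noncomputable def homographic (α β : K) : K⟦X⟧ :=
  PowerSeries.mk fun j => if j = 0 then 0 else (β - α) * β ^ (j - 1)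

theorem coeff_homographic_succ (α β : K) (j : ℕ) :
    coeff (j + 1) (homographic α β) = (β - α) * β ^ j := by
  simp [homographic]

theorem constantCoeff_homographic (α β : K) : constantCoeff (homographic α β) = 0 := by
  rw [← coeff_zero_eq_constantCoeff_apply]
  simp [homographic]

theorem one_add_homographic_mul (α β : K) :
    (1 + homographic α β) * (1 - C β * X) = 1 - C α * X := by
  have h : homographic α β - C β * (homographic α β * X) = C (β - α) * X := by
    ext n
    cases n with
    | zero => simp [constantCoeff_homographic]
    | succ n =>
      rw [map_sub, coeff_C_mul, coeff_C_mul, coeff_succ_mul_X, coeff_homographic_succ, coeff_X]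
      cases n with
      | zero => simp [constantCoeff_homographic]
      | succ n => rw [coeff_homographic_succ]; simp; ring
  have h' : (C (β - α) : K⟦X⟧) = C β - C α := map_sub _ _ _
  rw [h'] at h
  linear_combination h

/-- The composition law of weights is multiplication of the series 1 + θ, and (1 - αt)/(1 - βt) is
the product of 1 - αt and 1/(1 - βt). The proof cancels 1 - βt. -/
theorem homographic_mul (α β : K) :
    homographic α 0 + homographic 0 β + homographic α 0 * homographic 0 β = homographic α β := by
  have h1 := one_add_homographic_mul α (0 : K)
  have h2 := one_add_homographic_mul 0 β
  have h3 := one_add_homographic_mul α β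
  have hne : (1 - C β * X : K⟦X⟧) ≠ 0 := by
    intro h
    have := congrArg constantCoeff h
    simp at this
  rw [map_zero, zero_mul, sub_zero] at h1 h2
  rw [mul_one] at h1
  refine mul_right_cancel₀ hne ?_
  linear_combination (1 - C α * X) * h2 + (1 + homographic 0 β) * (1 - C β * X) * h1 - h3

theorem homographic_self (α : K) : homographic α α = 0 := by
  ext n
  simp [homographic]

theorem homographic_zero_left (β : K) (j : ℕ) :
    coeff j (homographic 0 β) = β ^ j * coeff j (homographic 0 (1 : K)) := by
  cases j with
  | zero => simp [constantCoeff_homographic]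
  | succ j => rw [coeff_homographic_succ, coeff_homographic_succ]; ring

theorem homographic_zero_right (α : K) (j : ℕ) :
    coeff j (homographic α 0) = α ^ j * coeff j (homographic (1 : K) 0) := by
  cases j with
  | zero => simp [constantCoeff_homographic]
  | succ j =>
    rw [coeff_homographic_succ, coeff_homographic_succ]
    cases j with
    | zero => ring
    | succ j => simp

/-- The substitution t ↦ αt in the weight multiplies a composition by α to the sum of its blocks,
which is always k. -/
theorem wordSeries_scale (a : ℕ) {θ η : K⟦X⟧} {α : K}
    (h : ∀ j, coeff j θ = α ^ j * coeff j η) (k : ℕ) :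
    wordSeries a θ k = α ^ k • wordSeries a η k := by
  rw [wordSeries, wordSeries, Finset.smul_sum]
  refine Finset.sum_congr rfl fun c _ => ?_
  rw [smul_smul]
  congr 1
  have : ∀ l : List ℕ, (l.map fun i => coeff i θ).prod =
      α ^ l.sum * (l.map fun i => coeff i η).prod := by
    intro l
    induction l with
    | nil => simp
    | cons i l ih => rw [List.map_cons, List.prod_cons, ih, h, List.sum_cons, List.map_cons,
        List.prod_cons, pow_add]; ring
  rw [this, c.blocks_sum]

theorem wordSeries_zero_weight (a : ℕ) : wordSeries a (0 : K⟦X⟧) = unitSeries K := by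
  rw [wordSeries_eq (by simp)]
  funext k
  simp [zOp]

end HomographicWeight

/-! ### The map S as a merging of blocks. -/

section Star

variable {K : Type*} [Field K]

open PowerSeries

theorem S_mul_letter (f : H K) (a : Letter) :
    S K (f * letter K a) = sigma K f * letter K a := by
  refine word_induction (p := fun f => S K (f * letter K a) = sigma K f * letter K a) f
    (fun w => S_concat w a) (by simp) (fun a b h1 h2 => by simp only [add_mul, map_add, h1, h2])
    (fun c a h => by rw [smul_mul_assoc, map_smul, h, map_smul, smul_mul_assoc])

theorem exists_zWord_eq_mul_y {l : List ℕ} (hl : l ≠ []) :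
    ∃ g, zWord K l = g * letter K .y := by
  induction l with
  | nil => exact absurd rfl hl
  | cons k l ih =>
    rw [zWord_cons]
    by_cases h : l = []
    · exact ⟨letter K .x ^ (k - 1), by rw [h, zWord_nil, mul_one, z]⟩
    · obtain ⟨g, hg⟩ := ih h
      exact ⟨z K k * g, by rw [hg, mul_assoc]⟩

theorem sigma_x : sigma K (letter K .x) = letter K .x := by simp [sigma, letter]

theorem sigma_y : sigma K (letter K .y) = letter K .x + letter K .y := by simp [sigma, letter]

theorem S_z (k : ℕ) : S K (z K k) = z K k := by
  rw [z, S_mul_letter, map_pow, sigma_x]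

/-- Only the last letter escapes σ, so z_k contributes σ(z_k) = z_k + x^k. The second term merges
z_k into the next block, as x^k z_l = z_{k+l}. -/
theorem S_z_mul_zWord {k : ℕ} (hk : 1 ≤ k) {l : List ℕ} (hl : l ≠ []) :
    S K (z K k * zWord K l) = z K k * S K (zWord K l) + letter K .x ^ k * S K (zWord K l) := by
  obtain ⟨g, hg⟩ := exists_zWord_eq_mul_y (K := K) hl
  obtain ⟨k, rfl⟩ := Nat.exists_eq_add_of_le' hk
  rw [hg, S_mul_letter, ← mul_assoc, S_mul_letter, map_mul, z, map_mul, map_pow, sigma_x, sigma_y,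
    Nat.add_sub_cancel, pow_succ]
  noncomm_ring

theorem x_pow_mul_z (k : ℕ) {l : ℕ} (hl : 1 ≤ l) :
    letter K .x ^ k * z K l = z K (k + l) := by
  rw [z, z, ← mul_assoc, ← pow_add, Nat.add_sub_assoc hl]

theorem x_pow_mul_zOp {a : ℕ} (ha : 1 ≤ a) {θ : K⟦X⟧} (hθ : constantCoeff θ = 0) (A : ℕ → H K)
    (m k : ℕ) : letter K .x ^ m * zOp a θ A k =
      ∑ q ∈ antidiagonal k, coeff q.1 θ • (z K (m + a * q.1) * A q.2) := by
  rw [zOp, Finset.mul_sum]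
  refine Finset.sum_congr rfl fun q _ => ?_
  rcases Nat.eq_zero_or_pos q.1 with h | h
  · simp [h, hθ]
  · rw [mul_smul_comm, ← mul_assoc, x_pow_mul_z m (Nat.mul_pos ha h)]

theorem sum_antidiagonal_assoc {M : Type*} [AddCommMonoid M] (f : ℕ → ℕ → ℕ → M) (k : ℕ) :
    ∑ q ∈ antidiagonal k, ∑ s ∈ antidiagonal q.2, f q.1 s.1 s.2 =
      ∑ q ∈ antidiagonal k, ∑ s ∈ antidiagonal q.1, f s.1 s.2 q.2 := by
  simp only [Finset.sum_sigma']
  refine Finset.sum_nbij' (fun s => ⟨(s.1.1 + s.2.1, s.2.2), (s.1.1, s.2.1)⟩)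
    (fun s => ⟨(s.2.1, s.2.2 + s.1.2), (s.2.2, s.1.2)⟩) ?_ ?_ ?_ ?_ ?_
  all_goals
    rintro ⟨⟨a, b⟩, ⟨c, d⟩⟩ h
    simp only [Finset.mem_sigma, mem_antidiagonal] at h ⊢
  · obtain ⟨h1, h2⟩ := h
    refine ⟨?_, ?_⟩ <;> first | trivial | omega
  · obtain ⟨h1, h2⟩ := h
    refine ⟨?_, ?_⟩ <;> first | trivial | omega
  · obtain ⟨h1, h2⟩ := h
    subst h2 h1; rfl
  · obtain ⟨h1, h2⟩ := h
    subst h2 h1; rfl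

/-- Coefficientwise form of θ = (yt/(1 - t))(1 + θ) for θ = yt/(1 - (1 + y)t): a block is either a
single original block, of weight y, or an original block merged with a following one. -/
theorem coeff_homographic_one_succ (y : K) (e : ℕ) :
    coeff (e + 1) (homographic 1 (1 + y)) =
      y + y * ∑ s ∈ antidiagonal e, coeff s.2 (homographic 1 (1 + y)) := by
  rw [Finset.Nat.sum_antidiagonal_eq_sum_range_succ
    (fun _ j => coeff j (homographic 1 (1 + y))) e,
    Nat.succ_eq_add_one, Finset.sum_flip (fun j => coeff j (homographic 1 (1 + y)))]
  induction e with
  | zero => simp [coeff_homographic_succ, constantCoeff_homographic]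
  | succ e ih =>
    rw [Finset.sum_range_succ, mul_add, ← add_assoc, ← ih, coeff_homographic_succ,
      coeff_homographic_succ]
    ring

theorem sum_S_zWord {a : ℕ} (ha : 1 ≤ a) (y : K) (k : ℕ) :
    ∑ c : Composition k, y ^ c.blocks.length • S K (zWord K (c.blocks.map (a * ·))) =
      wordSeries a (homographic 1 (1 + y)) k := by
  set θ := homographic 1 (1 + y) with hθ
  have hθ0 : constantCoeff θ = 0 := constantCoeff_homographic _ _
  induction k using Nat.strong_induction_on with
  | _ k ih =>
    cases k with
    | zero =>
      rw [sum_composition_zero (fun l => y ^ l.length • S K (zWord K (l.map (a * ·)))),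
        wordSeries_zero]
      simp [zWord_nil, S_nil]
    | succ k =>
      rw [sum_composition_succ (fun l => y ^ l.length • S K (zWord K (l.map (a * ·))))]
      have step : ∀ q ∈ antidiagonal k, ∑ c : Composition q.2, y ^ ((q.1 + 1) :: c.blocks).length •
          S K (zWord K (((q.1 + 1) :: c.blocks).map (a * ·))) =
          y • (z K (a * (q.1 + 1)) * wordSeries a θ q.2) +
            ∑ s ∈ antidiagonal q.2, (y * coeff s.1 θ) •
              (z K (a * (q.1 + s.1 + 1)) * wordSeries a θ s.2) := by
        rintro ⟨j, i⟩ hq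
        have hi := ih i (by have := mem_antidiagonal.1 hq; simp only at this; omega)
        have e2 : ∑ s ∈ antidiagonal i, (y * coeff s.1 θ) •
            (z K (a * (j + s.1 + 1)) * wordSeries a θ s.2) =
            y • (letter K .x ^ (a * (j + 1)) * zOp a θ (wordSeries a θ) i) := by
          rw [x_pow_mul_zOp ha hθ0, Finset.smul_sum]
          refine Finset.sum_congr rfl fun s _ => ?_
          rw [smul_smul, ← mul_add, add_right_comm]
        simp only
        rw [e2]
        -- With no further block there is nothing to merge and S(z_k) = z_k; the merging term is
        -- then absent because `zOp` vanishes in degree zero.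
        cases i with
        | zero =>
          rw [zOp_zero hθ0, sum_composition_zero (fun l => y ^ ((j + 1) :: l).length •
            S K (zWord K (((j + 1) :: l).map (a * ·)))), wordSeries_zero]
          simp [zWord_cons, zWord_nil, S_z]
        | succ i =>
          have e3 : zOp a θ (wordSeries a θ) (i + 1) = wordSeries a θ (i + 1) := by
            conv_rhs => rw [wordSeries_eq hθ0]
            simp [unitSeries]
          rw [e3, ← hi, Finset.mul_sum, Finset.mul_sum, ← smul_add, ← Finset.sum_add_distrib,
            Finset.smul_sum]
          refine Finset.sum_congr rfl fun c _ => ?_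
          have hc : c.blocks.map (a * ·) ≠ [] := by
            simp [Composition.blocks_eq_nil]
          rw [List.map_cons, zWord_cons, S_z_mul_zWord (Nat.mul_pos ha j.succ_pos) hc,
            List.length_cons, pow_succ', mul_smul, mul_smul_comm, mul_smul_comm, smul_add]
      -- The merged terms are regrouped by the size of the resulting first block, whose total weight
      -- is the one computed in `coeff_homographic_one_succ`.
      rw [Finset.sum_congr rfl step, Finset.sum_add_distrib,
        sum_antidiagonal_assoc (fun j p r => (y * coeff p θ) •
              (z K (a * (j + p + 1)) * wordSeries a θ r)), ← Finset.sum_add_distrib,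
        wordSeries_succ]
      refine Finset.sum_congr rfl fun q _ => ?_
      rw [coeff_homographic_one_succ, add_smul, Finset.mul_sum, Finset.sum_smul]
      congr 1
      refine Finset.sum_congr rfl fun s hs => ?_
      rw [mem_antidiagonal.1 hs]

end Star

/-! ### Restricted sums as convolutions, and Newton's identities. -/

section RestrictedSums

variable {K : Type*} [Field K] {R : Type*} [CommRing R] [Algebra K R]

open PowerSeries

/-- An arbitrary extension of Z to all of 𝔥 spares carrying membership proofs through sums; it is
only evaluated on 𝔥⁰, so the choice is immaterial. -/
theorem exists_extension (Z : h0 K →ₗ[K] R) :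
    ∃ Z' : H K →ₗ[K] R, ∀ f (hf : f ∈ h0 K), Z' f = Z ⟨f, hf⟩ := by
  obtain ⟨Z', h⟩ := LinearMap.exists_extend Z
  exact ⟨Z', fun f hf => by rw [← h]; rfl⟩

/-- A linear extension of `Z` to `𝔥`. -/
noncomputable def extension (Z : h0 K →ₗ[K] R) : H K →ₗ[K] R := (exists_extension Z).choose

theorem extension_eq (Z : h0 K →ₗ[K] R) {f : H K} (hf : f ∈ h0 K) :
    extension Z f = Z ⟨f, hf⟩ := (exists_extension Z).choose_spec f hf

theorem zeta_eq_extension (Z : h0 K →ₗ[K] R) {k : List ℕ} (hk : Admissible k) :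
    zeta Z k hk = extension Z (zWord K k) := (extension_eq Z _).symm

theorem zetaStar_eq_extension (Z : h0 K →ₗ[K] R) {k : List ℕ} (hk : Admissible k) :
    zetaStar Z k hk = extension Z (S K (zWord K k)) :=
  (extension_eq Z (S_mem_h0 hk.zWord_mem)).symm

theorem DoubleShuffle.extension_one {Z : h0 K →ₗ[K] R} (hZ : DoubleShuffle Z) :
    extension Z 1 = 1 := by
  rw [extension_eq Z one_mem_h0, hZ.map_one]

theorem DoubleShuffle.extension_stuffle {Z : h0 K →ₗ[K] R} (hZ : DoubleShuffle Z) {f g : H K}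
    (hf : f ∈ h0 K) (hg : g ∈ h0 K) :
    extension Z (stuffle K f g) = extension Z f * extension Z g := by
  rw [extension_eq Z hf, extension_eq Z hg, extension_eq Z (stuffle_mem_h0 hf hg)]
  exact hZ.map_stuffle ⟨f, hf⟩ ⟨g, hg⟩

theorem DoubleShuffle.extension_shuffle {Z : h0 K →ₗ[K] R} (hZ : DoubleShuffle Z) {f g : H K}
    (hf : f ∈ h0 K) (hg : g ∈ h0 K) :
    extension Z (shuffle K f g) = extension Z f * extension Z g := by
  rw [extension_eq Z hf, extension_eq Z hg, extension_eq Z (shuffle_mem_h0 hf hg)]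
  exact hZ.map_shuffle ⟨f, hf⟩ ⟨g, hg⟩

/-- `(-1)^i ζ_R(a, …, a)`, with `i` arguments. -/
noncomputable def elemZeta (Z : h0 K →ₗ[K] R) (a i : ℕ) : R :=
  extension Z (wordSeries a (homographic 1 0) i)

/-- `ζ_R^⋆(a, …, a)`, with `i` arguments. -/
noncomputable def homZeta (Z : h0 K →ₗ[K] R) (a i : ℕ) : R :=
  extension Z (wordSeries a (homographic 0 1) i)

theorem elemZeta_zero {Z : h0 K →ₗ[K] R} (hZ : DoubleShuffle Z) (a : ℕ) : elemZeta Z a 0 = 1 := by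
  rw [elemZeta, wordSeries_zero, hZ.extension_one]

theorem extension_wordSeries_homographic {Z : h0 K →ₗ[K] R} (hZ : DoubleShuffle Z) {a : ℕ}
    (ha : 2 ≤ a) (α β : K) (k : ℕ) :
    extension Z (wordSeries a (homographic α β) k) =
      ∑ q ∈ antidiagonal k, (α ^ q.1 * β ^ q.2) • (elemZeta Z a q.1 * homZeta Z a q.2) := by
  rw [← homographic_mul, ← stuffleConv_wordSeries (by omega) (constantCoeff_homographic _ _)
    (constantCoeff_homographic _ _), stuffleConv, map_sum]
  refine Finset.sum_congr rfl fun q _ => ?_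
  rw [hZ.extension_stuffle (wordSeries_mem_h0 ha _ _) (wordSeries_mem_h0 ha _ _),
    wordSeries_scale a (homographic_zero_left β), wordSeries_scale a (homographic_zero_right α),
    map_smul, map_smul, smul_mul_smul_comm, elemZeta, homZeta]

/-- For α = β = 1 the weight vanishes and only the empty composition survives. -/
theorem sum_elemZeta_mul_homZeta {Z : h0 K →ₗ[K] R} (hZ : DoubleShuffle Z) {a : ℕ} (ha : 2 ≤ a)
    (k : ℕ) : ∑ q ∈ antidiagonal k, elemZeta Z a q.1 * homZeta Z a q.2 = if k = 0 then 1 else 0 := by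
  have := extension_wordSeries_homographic hZ ha 1 1 k
  simp only [one_pow, mul_one, one_smul] at this
  rw [← this, homographic_self, wordSeries_zero_weight, unitSeries]
  split_ifs
  · exact hZ.extension_one
  · exact map_zero _

theorem sum_composition_eq_sum_length {M : Type*} [AddCommMonoid M] [Module K M] {k : ℕ} (y : K)
    (f : Composition k → M) :
    ∑ c, y ^ c.blocks.length • f c =
      ∑ n ∈ Finset.range (k + 1), y ^ n • ∑ c : Composition k with c.length = n, f c := by
  rw [← Finset.sum_fiberwise_of_maps_to (s := Finset.univ) (t := Finset.range (k + 1))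
    (g := fun c : Composition k => c.length)
    (fun c _ => Finset.mem_range.2 (Nat.lt_succ_of_le c.length_le))]
  refine Finset.sum_congr rfl fun n _ => ?_
  rw [Finset.smul_sum]
  refine Finset.sum_congr rfl fun c hc => ?_
  rw [c.blocks_length, (Finset.mem_filter.1 hc).2]

/-- Linear functionals on V reduce the claim to polynomials over K that agree at every point of an
infinite field. -/
theorem coeff_eq_of_forall_sum_eq [Infinite K] {V : Type*} [AddCommGroup V] [Module K V] {N : ℕ}
    {v w : ℕ → V} (h : ∀ y : K, ∑ n ∈ Finset.range N, y ^ n • v n =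
      ∑ n ∈ Finset.range N, y ^ n • w n) {n : ℕ} (hn : n < N) : v n = w n := by
  rw [← sub_eq_zero, ← Module.forall_dual_apply_eq_zero_iff K]
  intro f
  have h0 : (∑ i ∈ Finset.range N, Polynomial.monomial i (f (v i - w i)) : Polynomial K) = 0 := by
    refine Polynomial.funext fun y => ?_
    have := congrArg f (sub_eq_zero.2 (h y))
    rw [← Finset.sum_sub_distrib, map_sum, map_zero] at this
    rw [Polynomial.eval_finsetSum, Polynomial.eval_zero, ← this]
    refine Finset.sum_congr rfl fun i _ => ?_
    rw [Polynomial.eval_monomial, ← smul_sub, map_smul, smul_eq_mul, mul_comm]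
  have := congrArg (fun p => Polynomial.coeff p n) h0
  simpa [Polynomial.finsetSum_coeff, Polynomial.coeff_monomial, hn] using this

theorem add_pow_eq_sum_range {i k : ℕ} (h : i ≤ k) (c y : K) :
    (1 + c * y) ^ i = ∑ n ∈ Finset.range (k + 1), y ^ n * (c ^ n * (i.choose n : K)) := by
  rw [add_comm, add_pow]
  refine (Finset.sum_subset (Finset.range_mono (by omega)) fun n _ hn => ?_).trans
    (Finset.sum_congr rfl fun n _ => ?_)
  · rw [Nat.choose_eq_zero_of_lt (by simpa using hn)]; simp
  · rw [mul_pow, one_pow]; ring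

/-- The restricted sums in terms of the values `ζ_R(a, …, a)` and `ζ_R^⋆(a, …, a)`. -/
theorem restrictedSum_eq [CharZero K] {Z : h0 K →ₗ[K] R} (hZ : DoubleShuffle Z) {a : ℕ}
    (ha : 2 ≤ a) {k n : ℕ} (hn : n ≤ k) :
    restrictedSum Z ha k n = ∑ q ∈ antidiagonal k,
      ((-1) ^ n * (q.1.choose n : K)) • (elemZeta Z a q.1 * homZeta Z a q.2) := by
  refine coeff_eq_of_forall_sum_eq (K := K) (N := k + 1) (v := fun n => restrictedSum Z ha k n)
    (w := fun n => ∑ q ∈ antidiagonal k,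
      ((-1) ^ n * (q.1.choose n : K)) • (elemZeta Z a q.1 * homZeta Z a q.2))
    (fun y => ?_) (Nat.lt_succ_of_le hn)
  -- With α = 1 - y and β = 1 the weight is yt/(1 - t), so each block counts y. On the other side (1
  -- - y)^i is expanded by the binomial theorem.
  have h1 := extension_wordSeries_homographic hZ ha (1 + (-1) * y) 1 k
  have h2 : extension Z (wordSeries a (homographic (1 + (-1) * y) 1) k) =
      ∑ c : Composition k, y ^ c.blocks.length •
        zeta Z (c.blocks.map (a * ·)) (admissible_map ha c) := by
    rw [wordSeries, map_sum]
    refine Finset.sum_congr rfl fun c _ => ?_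
    rw [map_smul, zeta_eq_extension]
    congr 1
    have : ∀ i ∈ c.blocks, coeff i (homographic (1 + (-1) * y) 1) = y := by
      intro i hi
      obtain ⟨j, rfl⟩ := Nat.exists_eq_add_of_le' (c.one_le_blocks hi)
      rw [coeff_homographic_succ]
      ring
    rw [List.map_congr_left this]
    simp
  rw [sum_composition_eq_sum_length] at h2
  simp only [restrictedSum]
  rw [← h2, h1]
  simp only [Finset.smul_sum, smul_smul]
  rw [Finset.sum_comm]
  refine Finset.sum_congr rfl fun q hq => ?_
  rw [← Finset.sum_smul, ← add_pow_eq_sum_range (by have := mem_antidiagonal.1 hq; omega), one_pow,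
    mul_one]

/-- The restricted sums of the star values in terms of the values `ζ_R(a, …, a)` and
`ζ_R^⋆(a, …, a)`. -/
theorem restrictedSumStar_eq [CharZero K] {Z : h0 K →ₗ[K] R} (hZ : DoubleShuffle Z) {a : ℕ}
    (ha : 2 ≤ a) {k n : ℕ} (hn : n ≤ k) :
    restrictedSumStar Z ha k n = ∑ q ∈ antidiagonal k,
      (q.2.choose n : K) • (elemZeta Z a q.1 * homZeta Z a q.2) := by
  refine coeff_eq_of_forall_sum_eq (K := K) (N := k + 1) (v := fun n => restrictedSumStar Z ha k n)
    (w := fun n => ∑ q ∈ antidiagonal k,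
      (q.2.choose n : K) • (elemZeta Z a q.1 * homZeta Z a q.2))
    (fun y => ?_) (Nat.lt_succ_of_le hn)
  -- Here the depth variable sits in β, so the binomial coefficients attach to the index of
  -- `homZeta`.
  have h1 := extension_wordSeries_homographic hZ ha 1 (1 + y) k
  have h2 : extension Z (wordSeries a (homographic 1 (1 + y)) k) =
      ∑ c : Composition k, y ^ c.blocks.length •
        zetaStar Z (c.blocks.map (a * ·)) (admissible_map ha c) := by
    rw [← sum_S_zWord (by omega), map_sum]
    exact Finset.sum_congr rfl fun c _ => by rw [map_smul, zetaStar_eq_extension]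
  rw [sum_composition_eq_sum_length] at h2
  simp only [restrictedSumStar]
  rw [← h2, h1]
  simp only [Finset.smul_sum, smul_smul]
  rw [Finset.sum_comm]
  refine Finset.sum_congr rfl fun q hq => ?_
  have := add_pow_eq_sum_range (by have := mem_antidiagonal.1 hq; omega : q.2 ≤ k) 1 y
  simp only [one_mul, one_pow] at this
  rw [← Finset.sum_smul, ← this, one_pow, one_mul]

theorem restrictedSum_one {Z : h0 K →ₗ[K] R} {a : ℕ} (ha : 2 ≤ a) {k : ℕ} (hk : 0 < k) :
    restrictedSum Z ha k 1 = extension Z (z K (a * k)) := by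
  rw [restrictedSum, Finset.sum_eq_single (Composition.single k hk)]
  · rw [zeta_eq_extension]
    simp [zWord]
  · intro c hc hne
    exact absurd (Composition.eq_single_iff_length hk |>.2 (Finset.mem_filter.1 hc).2) hne
  · intro h
    simp at h

/-- The relation between `ζ_R(ak)` and the values `ζ_R(a, …, a)`, in the form of Newton's
identities. -/
theorem newton_elemZeta [CharZero K] {Z : h0 K →ₗ[K] R} (hZ : DoubleShuffle Z) {a : ℕ}
    (ha : 2 ≤ a) {k : ℕ} (hk : 0 < k) : extension Z (z K (a * k)) =
      - ∑ q ∈ antidiagonal k, (q.1 : R) * elemZeta Z a q.1 * homZeta Z a q.2 := by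
  -- At n = 1 the restricted sum has the single term ζ_R(ak), and the binomial coefficient becomes
  -- the index itself.
  rw [← restrictedSum_one ha hk, restrictedSum_eq hZ ha hk, ← Finset.sum_neg_distrib]
  refine Finset.sum_congr rfl fun q _ => ?_
  rw [Nat.choose_one_right, pow_one, neg_one_mul, neg_smul, Nat.cast_smul_eq_nsmul, nsmul_eq_mul,
    mul_assoc]

end RestrictedSums

/-! ### Shuffle and stuffle products of two letters z_k. -/

section DepthTwo

variable {K : Type*} [Field K]

theorem z_succ_eq_word (a : ℕ) : z K (a + 1) = word K (List.replicate a .x ++ [.y]) := by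
  simp [z, word]

theorem z_succ_succ (a : ℕ) : z K (a + 2) = letter K .x * z K (a + 1) := by
  rw [z, z, ← mul_assoc, ← pow_succ', Nat.add_sub_cancel]; rfl

/-- The shuffle product `z_{a+1} ⧢ z_{b+1}`. -/
noncomputable def shuffleZ (K : Type*) [Field K] (a b : ℕ) : H K :=
  shuffle K (z K (a + 1)) (z K (b + 1))

theorem shuffleZ_succ_succ (a b : ℕ) : shuffleZ K (a + 1) (b + 1) =
    letter K .x * shuffleZ K a (b + 1) + letter K .x * shuffleZ K (a + 1) b := by
  simp only [shuffleZ, z_succ_eq_word, shuffle_word, List.replicate_succ, List.cons_append]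
  rw [shuffleWord]

theorem shuffleZ_zero_succ (b : ℕ) : shuffleZ K 0 (b + 1) =
    z K 1 * z K (b + 2) + letter K .x * shuffleZ K 0 b := by
  simp only [shuffleZ, z_succ_eq_word, shuffle_word, List.replicate_succ, List.cons_append]
  rw [List.replicate_zero, List.nil_append, shuffleWord, shuffleWord]
  simp [word]

theorem shuffleZ_succ_zero (b : ℕ) : shuffleZ K (b + 1) 0 =
    letter K .x * shuffleZ K b 0 + z K 1 * z K (b + 2) := by
  simp only [shuffleZ, z_succ_eq_word, shuffle_word, List.replicate_succ, List.cons_append]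
  rw [List.replicate_zero, List.nil_append, shuffleWord, shuffleWord_nil_right]
  simp [word]

theorem shuffleZ_zero_comm (b : ℕ) : shuffleZ K b 0 = shuffleZ K 0 b := by
  induction b with
  | zero => rfl
  | succ b ih => rw [shuffleZ_succ_zero, shuffleZ_zero_succ, ih, add_comm]

theorem shuffleZ_zero (b : ℕ) : shuffleZ K 0 b =
    ∑ q ∈ antidiagonal b, z K (q.1 + 1) * z K (q.2 + 1) + z K (b + 1) * z K 1 := by
  induction b with
  | zero =>
    simp only [shuffleZ, z_succ_eq_word, shuffle_word]
    simp [shuffleWord, word]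
  | succ b ih =>
    rw [shuffleZ_zero_succ, ih, Finset.Nat.sum_antidiagonal_succ, mul_add, Finset.mul_sum]
    simp only [add_assoc, Nat.reduceAdd, z_succ_succ, mul_assoc, zero_add]

theorem x_mul_shuffleZ_zero (b : ℕ) : letter K .x * shuffleZ K 0 b =
    ∑ q ∈ antidiagonal b, z K (q.1 + 2) * z K (q.2 + 1) + z K (b + 2) * z K 1 := by
  rw [shuffleZ_zero, mul_add, Finset.mul_sum]
  simp only [z_succ_succ, mul_assoc]

/-- The sum telescopes: consecutive terms share a value of f with opposite signs, leaving the two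
ends. -/
theorem sum_antidiagonal_neg_one_pow_shift {A : Type*} [Ring A] (f : ℕ → ℕ → A) (M : ℕ) :
    ∑ q ∈ antidiagonal M, (-1 : A) ^ q.1 * (f q.1 (q.2 + 1) + f (q.1 + 1) q.2) =
      f 0 (M + 1) + (-1) ^ M * f (M + 1) 0 := by
  have h1 := Finset.Nat.sum_antidiagonal_succ (n := M) (f := fun q => (-1 : A) ^ q.1 * f q.1 q.2)
  have h2 := Finset.Nat.sum_antidiagonal_succ' (n := M) (f := fun q => (-1 : A) ^ q.1 * f q.1 q.2)
  rw [h1] at h2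
  simp only [pow_zero, one_mul, pow_succ, mul_neg, mul_one, neg_mul, Finset.sum_neg_distrib] at h2
  simp only [mul_add, Finset.sum_add_distrib]
  rw [← sub_eq_zero]
  rw [← sub_eq_zero] at h2
  rw [← neg_eq_zero, ← h2]
  abel

theorem sum_neg_one_pow_shuffleZ {M : ℕ} (hM : Even M) :
    ∑ q ∈ antidiagonal M, (-1 : H K) ^ q.1 * shuffleZ K (q.1 + 1) (q.2 + 1) =
      2 * (letter K .x * shuffleZ K 0 (M + 1)) := by
  have h := sum_antidiagonal_neg_one_pow_shift (fun a b => letter K .x * shuffleZ K a b) M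
  simp only [← shuffleZ_succ_succ] at h
  rw [h, hM.neg_one_pow, shuffleZ_zero_comm, one_mul, two_mul]

theorem stuffle_z {k l : ℕ} (hk : 1 ≤ k) (hl : 1 ≤ l) :
    stuffle K (z K k) (z K l) = z K k * z K l + z K l * z K k + z K (k + l) := by
  have hm : ∀ k, z K k ∈ h1 K := fun k => by simpa using z_mul_mem_h1 k one_mem_h1
  have := stuffle_z_mul hk hl (one_mem_h1 (K := K)) one_mem_h1
  simp only [mul_one] at this
  rw [this, one_stuffle (hm l), stuffle_one (hm k), one_stuffle one_mem_h1, mul_one]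

theorem z_mem_h1 (k : ℕ) : z K k ∈ h1 K := by simpa using z_mul_mem_h1 k one_mem_h1

theorem z_mem_h0 {k : ℕ} (hk : 2 ≤ k) : z K k ∈ h0 K := by simpa using z_mul_mem_h0 hk one_mem_h1

/-- An element of 𝔥⁰ is its own expansion, concentrated in degree zero in y, and expansions are
unique. -/
theorem regShuffle_of_mem_h0 [CharZero K] (f : h1 K) (hf : (f : H K) ∈ h0 K) :
    regShuffle f = ⟨f, hf⟩ := by
  have h := existsUnique_shuffleExpansion f.2
  have : h.choose = Finsupp.single 0 ⟨f, hf⟩ := by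
    refine h.unique h.choose_spec.1 ?_
    simp [shuffleExpansion, yPow, shuffle_one]
  rw [regShuffle, this, Finsupp.single_eq_same]

theorem sum_antidiagonal_even {A : Type*} [CommRing A] (f : ℕ → ℕ → A) (t : ℕ) :
    ∑ q ∈ antidiagonal (2 * t), (1 + (-1) ^ q.1) * f q.1 q.2 =
      2 * ∑ q ∈ antidiagonal t, f (2 * q.1) (2 * q.2) := by
  rw [Finset.mul_sum]
  symm
  refine Finset.sum_of_injOn (fun q => (2 * q.1, 2 * q.2)) ?_ ?_ ?_ ?_
  · rintro ⟨a, b⟩ _ ⟨c, d⟩ _ h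
    simp only [Prod.mk.injEq] at h ⊢
    omega
  · rintro ⟨a, b⟩ h
    simp only [Finset.mem_coe, mem_antidiagonal] at h ⊢
    omega
  · rintro ⟨a, b⟩ h h'
    rcases Nat.even_or_odd' a with ⟨c, rfl | rfl⟩
    · exfalso
      refine h' ⟨(c, t - c), ?_, ?_⟩
      · simp only [Finset.mem_coe, mem_antidiagonal] at h ⊢
        omega
      · simp only [mem_antidiagonal] at h
        simp only [Prod.mk.injEq, true_and]
        omega
    · simp [pow_succ]
  · rintro ⟨a, b⟩ _
    simp only [pow_mul, neg_one_sq, one_pow]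
    ring

end DepthTwo

/-! ### The quadratic relation between the values at even integers. -/

section EvenZeta

variable {K : Type*} [Field K] {R : Type*} [CommRing R] [Algebra K R]

theorem x_mul_shuffleZ_zero_mem_h0 (b : ℕ) : letter K .x * shuffleZ K 0 b ∈ h0 K := by
  rw [x_mul_shuffleZ_zero]
  exact add_mem (sum_mem fun q _ => z_mul_mem_h0 (by omega) (z_mem_h1 _))
    (z_mul_mem_h0 (by omega) (z_mem_h1 _))

/-- This is the regularized relation for w₁ = y and w₀ = z_{b+2}. The only inadmissible word, z_1
z_{b+2}, occurs in both products and cancels, so the difference lies in 𝔥⁰ and regularization does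
nothing. -/
theorem RegularizedDoubleShuffle.extension_x_mul_shuffleZ [CharZero K] {Z : h0 K →ₗ[K] R}
    (hZ : RegularizedDoubleShuffle Z) (b : ℕ) :
    extension Z (letter K .x * shuffleZ K 0 b) =
      extension Z (z K (b + 2) * z K 1) + extension Z (z K (b + 3)) := by
  have hd : shuffle K (z K 1) (z K (b + 2)) - stuffle K (z K 1) (z K (b + 2)) =
      letter K .x * shuffleZ K 0 b - (z K (b + 2) * z K 1 + z K (b + 3)) := by
    have : shuffle K (z K 1) (z K (b + 2)) = shuffleZ K 0 (b + 1) := rfl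
    rw [this, shuffleZ_zero_succ, stuffle_z le_rfl (by omega), show 1 + (b + 2) = b + 3 by omega]
    abel
  have hm : letter K .x * shuffleZ K 0 b - (z K (b + 2) * z K 1 + z K (b + 3)) ∈ h0 K :=
    sub_mem (x_mul_shuffleZ_zero_mem_h0 b)
      (add_mem (z_mul_mem_h0 (by omega) (z_mem_h1 _)) (z_mem_h0 (by omega)))
  have h := hZ.map_reg ⟨z K 1, z_mem_h1 1⟩ ⟨z K (b + 2), z_mem_h0 (by omega)⟩
  rw [regShuffle_of_mem_h0 _ (by simp only; rw [hd]; exact hm), ← extension_eq] at h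
  simp only at h
  rw [hd, map_sub, map_add, sub_eq_zero] at h
  exact h

/-- The convolution identity of the values at the even integers, which is a consequence of the
double shuffle relations in depth two. -/
theorem RegularizedDoubleShuffle.sum_even_zeta [CharZero K] {Z : h0 K →ₗ[K] R}
    (hZ : RegularizedDoubleShuffle Z) (t : ℕ) :
    2 * ∑ q ∈ antidiagonal t, extension Z (z K (2 * q.1 + 2)) * extension Z (z K (2 * q.2 + 2)) =
      (2 * t + 5) * extension Z (z K (2 * t + 4)) := by
  set d : ℕ → ℕ → R := fun a b => extension Z (z K (a + 2) * z K (b + 2)) with hd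
  set e : R := extension Z (z K (2 * t + 4)) with he
  set u : R := extension Z (z K (2 * t + 3) * z K 1) with hu
  have hreg := hZ.extension_x_mul_shuffleZ (2 * t + 1)
  -- the sum formula
  have h1 : ∑ q ∈ antidiagonal (2 * t), d q.1 q.2 + u = e := by
    have h := hreg
    rw [x_mul_shuffleZ_zero, map_add, map_sum, Finset.Nat.sum_antidiagonal_succ',
      add_comm (extension Z _)] at h
    simp only [add_assoc, Nat.reduceAdd] at h
    linear_combination h
  have hprod : ∀ q ∈ antidiagonal (2 * t), extension Z (z K (q.1 + 2)) * extension Z (z K (q.2 + 2))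
      = d q.1 q.2 + d q.2 q.1 + e := by
    intro q hq
    rw [← hZ.extension_stuffle (z_mem_h0 (by omega)) (z_mem_h0 (by omega)),
      stuffle_z (by omega) (by omega), map_add, map_add,
      show q.1 + 2 + (q.2 + 2) = 2 * t + 4 by rw [← mem_antidiagonal.1 hq]; omega]
  -- the alternating sum
  have h2 : ∑ q ∈ antidiagonal (2 * t), (-1) ^ q.1 * (d q.1 q.2 + d q.2 q.1 + e) =
      2 * (u + e) := by
    have h := congrArg (extension Z) (sum_neg_one_pow_shuffleZ (K := K) (even_two_mul t))
    rw [map_sum, two_mul (_ * _), map_add, ← two_mul, hreg] at h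
    rw [← h]
    refine Finset.sum_congr rfl fun q hq => ?_
    rw [← hprod q hq, ← hZ.extension_shuffle (z_mem_h0 (by omega)) (z_mem_h0 (by omega))]
    rcases Nat.even_or_odd q.1 with h | h
    · rw [h.neg_one_pow, h.neg_one_pow, one_mul, one_mul]; rfl
    · rw [h.neg_one_pow, h.neg_one_pow, neg_one_mul, neg_one_mul, map_neg]; rfl
  have h3 : ∑ q ∈ antidiagonal (2 * t), (-1 : R) ^ q.1 * d q.2 q.1 =
      ∑ q ∈ antidiagonal (2 * t), (-1 : R) ^ q.1 * d q.1 q.2 := by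
    rw [← Finset.Nat.sum_antidiagonal_swap]
    refine Finset.sum_congr rfl fun q hq => ?_
    have hq := mem_antidiagonal.1 hq
    simp only [Prod.fst_swap, Prod.snd_swap]
    rw [neg_one_pow_congr (by rw [← Nat.even_add, add_comm, hq]; exact even_two_mul t)]
  have h4 : ∑ q ∈ antidiagonal (2 * t), (-1 : R) ^ q.1 = 1 := by
    rw [Finset.Nat.sum_antidiagonal_eq_sum_range_succ (fun i _ => (-1 : R) ^ i), neg_one_geom_sum,
      if_neg (by simp)]
  simp only [mul_add, Finset.sum_add_distrib, ← Finset.sum_mul] at h2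
  rw [h3, h4] at h2
  -- Adding the plain and the alternating sum isolates the terms with both arguments even; the
  -- unknown u then cancels between `h1` and `h2`.
  have h5 := sum_antidiagonal_even d t
  simp only [add_mul, one_mul, Finset.sum_add_distrib] at h5
  have h6 : ∑ q ∈ antidiagonal t,
      extension Z (z K (2 * q.1 + 2)) * extension Z (z K (2 * q.2 + 2)) =
      ∑ q ∈ antidiagonal t, (d (2 * q.1) (2 * q.2) + d (2 * q.2) (2 * q.1) + e) :=
    Finset.sum_congr rfl fun q hq => hprod (2 * q.1, 2 * q.2) (by
      have := mem_antidiagonal.1 hq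
      exact mem_antidiagonal.2 (by simp only; omega))
  have h7 : ∑ q ∈ antidiagonal t, d (2 * q.2) (2 * q.1) =
      ∑ q ∈ antidiagonal t, d (2 * q.1) (2 * q.2) :=
    Finset.Nat.sum_antidiagonal_swap (f := fun q => d (2 * q.1) (2 * q.2))
  rw [h6, Finset.sum_add_distrib, Finset.sum_add_distrib, h7, Finset.sum_const,
    Finset.Nat.card_antidiagonal, nsmul_eq_mul]
  push_cast
  linear_combination 2 * h1 + h2 - 2 * h5

end EvenZeta

/-! ### Newton's recursion and the uniqueness of its solution. -/

section Newton

open PowerSeries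

theorem coeff_X_mul_derivative {A : Type*} [CommRing A] (g : A⟦X⟧) (n : ℕ) :
    coeff n (X * d⁄dX A g) = n * coeff n g := by
  cases n with
  | zero => simp
  | succ n => rw [coeff_succ_X_mul, coeff_derivative, mul_comm]; push_cast; rfl

/-- The coefficients of the series `g` with `t g' = (∑ pⱼ tʲ) g` and constant term `1`. -/
def newtonSeq (p : ℕ → ℚ) : ℕ → ℚ
  | 0 => 1
  | n + 1 => (∑ j : Fin (n + 1), p (j + 1) * newtonSeq p (n - j)) / (n + 1)

theorem newtonSeq_succ (p : ℕ → ℚ) (n : ℕ) : ((n + 1 : ℕ) : ℚ) * newtonSeq p (n + 1) =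
    ∑ q ∈ antidiagonal n, p (q.1 + 1) * newtonSeq p q.2 := by
  rw [newtonSeq, Finset.Nat.sum_antidiagonal_eq_sum_range_succ
    (fun i j => p (i + 1) * newtonSeq p j), Finset.sum_range, Nat.cast_succ,
    mul_div_cancel₀ _ (by positivity)]

/-- The solutions of Newton's identities. -/
theorem eq_newtonSeq_smul {K A : Type*} [Field K] [CharZero K] [CommRing A] [Algebra K A]
    {p : ℕ → ℚ} (hp : p 0 = 0) (M : A) {s : ℕ → A} (h0 : s 0 = 1)
    (hs : ∀ n : ℕ, (n : A) * s n = ∑ q ∈ antidiagonal n, ((p q.1 : K) • M ^ q.1) * s q.2) (n : ℕ) :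
    s n = (newtonSeq p n : K) • M ^ n := by
  induction n using Nat.strong_induction_on with
  | _ n ih =>
    cases n with
    | zero => simp [h0, newtonSeq]
    | succ n =>
      have h := hs (n + 1)
      rw [Finset.Nat.sum_antidiagonal_succ, hp, Rat.cast_zero, zero_smul, zero_mul, zero_add] at h
      have e : ∀ q ∈ antidiagonal n, ((p (q.1 + 1) : K) • M ^ (q.1 + 1)) * s q.2 =
          ((p (q.1 + 1) * newtonSeq p q.2 : ℚ) : K) • M ^ (n + 1) := by
        intro q hq
        have hq := mem_antidiagonal.1 hq
        rw [ih q.2 (by omega), smul_mul_smul_comm, ← pow_add, Rat.cast_mul,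
          show q.1 + 1 + q.2 = n + 1 by omega]
      rw [Finset.sum_congr rfl e, ← Finset.sum_smul, ← Rat.cast_sum, ← newtonSeq_succ,
        Rat.cast_mul, mul_smul, Rat.cast_natCast, ← nsmul_eq_mul, ← Nat.cast_smul_eq_nsmul K] at h
      -- A need not be a domain, but n + 1 is invertible in K and hence can be cancelled.
      exact smul_right_injective A (r := ((n + 1 : ℕ) : K)) (by exact_mod_cast n.succ_ne_zero) h

end Newton

/-! ### The series sinh z / z, its inverse, and its logarithmic derivative. -/

section HyperbolicSine

open PowerSeries

/-- The series `sinh z / z` in the variable `z²`. -/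
def sinhSeries : ℚ⟦X⟧ := PowerSeries.mk fun n => 1 / (2 * n + 1)!

/-- The series `z / sinh z` in the variable `z²`. -/
def sinhInv : ℚ⟦X⟧ := PowerSeries.mk fun n => (2 - 4 ^ n) * bernoulli (2 * n) / (2 * n)!

/-- The logarithmic derivative of `sinhSeries`. -/
noncomputable def sinhLog : ℚ⟦X⟧ := X * d⁄dX ℚ sinhSeries * sinhInv

/-- With B(t) = t/(e^t - 1), one has 2B(t) - B(2t) = 2t e^t/(e^{2t} - 1) = 2t/(e^t - e^{-t}), which
is t / sinh t. This is the source of the factors 2 - 4ⁿ. -/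
theorem bernoulli_exp_identity :
    (2 * bernoulliPowerSeries ℚ - rescale 2 (bernoulliPowerSeries ℚ)) *
      (exp ℚ - evalNegHom (exp ℚ)) = 2 * X := by
  have h1 := bernoulliPowerSeries_mul_exp_sub_one ℚ
  have h2 := congrArg (rescale (2 : ℚ)) h1
  have h3 : rescale (2 : ℚ) (exp ℚ) = exp ℚ ^ 2 := by
    have := exp_pow_eq_rescale_exp (A := ℚ) 2
    rw [this]; norm_num
  have h4 := exp_mul_exp_neg_eq_one (A := ℚ)
  have h5 : (C (2 : ℚ) : ℚ⟦X⟧) = 2 := map_ofNat _ 2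
  rw [map_mul, map_sub, map_one, rescale_X, h3, h5] at h2
  set B := bernoulliPowerSeries ℚ
  set B' := rescale (2 : ℚ) B
  set e := exp ℚ
  set e' := evalNegHom e
  linear_combination 2 * (e + 1) * e' * h1 - e' * h2 + (2 * X - (2 * B - B') * e) * h4

theorem sum_sinhInv_sinhSeries (n : ℕ) :
    ∑ q ∈ antidiagonal n, coeff q.1 sinhInv * coeff q.2 sinhSeries = if n = 0 then 1 else 0 := by
  -- The odd coefficients carry the information: e^t - e^{-t} is odd, so only even Bernoulli indices
  -- contribute.
  have h := congrArg (coeff (2 * n + 1)) bernoulli_exp_identity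
  rw [coeff_mul, Finset.Nat.sum_antidiagonal_succ'] at h
  set b := 2 * bernoulliPowerSeries ℚ - rescale 2 (bernoulliPowerSeries ℚ) with hb
  have hb' : ∀ i, coeff i b = (2 - 2 ^ i) * bernoulli i / i ! := by
    intro i
    have h5 : (2 : ℚ⟦X⟧) = C (2 : ℚ) := (map_ofNat C 2).symm
    rw [hb, map_sub, h5, coeff_C_mul, coeff_rescale]
    simp only [bernoulliPowerSeries, coeff_mk, Algebra.algebraMap_self, RingHom.id_apply]
    ring
  have he : ∀ i, coeff i (exp ℚ - evalNegHom (exp ℚ)) = (1 - (-1) ^ i) / i ! := by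
    intro i
    rw [map_sub, evalNegHom, coeff_rescale, coeff_exp]
    simp only [Algebra.algebraMap_self, RingHom.id_apply]
    ring
  have e : ∀ q ∈ antidiagonal (2 * n), coeff q.1 b * coeff (q.2 + 1) (exp ℚ - evalNegHom (exp ℚ)) =
      (1 + (-1) ^ q.1) * ((2 - 2 ^ q.1) * bernoulli q.1 / (q.1)! * (1 / (q.2 + 1)!)) := by
    intro q hq
    rw [hb', he, pow_succ, neg_one_pow_congr (m := q.2) (n := q.1) (by
      rw [← Nat.even_add, add_comm, mem_antidiagonal.1 hq]; exact even_two_mul n)]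
    ring
  rw [Finset.sum_congr rfl e, sum_antidiagonal_even
    (fun i j => (2 - 2 ^ i) * bernoulli i / i ! * (1 / ((j + 1)! : ℚ))), he] at h
  have h5 : (2 : ℚ⟦X⟧) = C (2 : ℚ) := (map_ofNat C 2).symm
  rw [h5, coeff_C_mul, coeff_X] at h
  simp only [pow_zero, sub_self, zero_div, mul_zero, zero_add, add_eq_right, mul_eq_zero,
    OfNat.ofNat_ne_zero, false_or] at h
  simp only [sinhInv, sinhSeries, coeff_mk]
  simpa only [pow_mul, show (2 : ℚ) ^ 2 = 4 by norm_num] using mul_left_cancel₀ two_ne_zero h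

theorem sinhInv_mul_sinhSeries : sinhInv * sinhSeries = 1 := by
  ext n
  rw [coeff_mul, sum_sinhInv_sinhSeries, coeff_one]

theorem sinhSeries_logDeriv : X * d⁄dX ℚ sinhSeries = sinhLog * sinhSeries := by
  rw [sinhLog, mul_assoc, sinhInv_mul_sinhSeries, mul_one]

theorem sinhInv_logDeriv : X * d⁄dX ℚ sinhInv = -sinhLog * sinhInv := by
  have h := congrArg (d⁄dX ℚ) sinhInv_mul_sinhSeries
  rw [Derivation.leibniz, derivative_one, smul_eq_mul, smul_eq_mul] at h
  rw [sinhLog]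
  linear_combination X * sinhInv * h - X * (d⁄dX ℚ sinhInv) * sinhInv_mul_sinhSeries

/-- The equation (zf)'' = zf for f = sinh z / z, rewritten in the variable z². -/
theorem sinhSeries_ode :
    4 * (X * d⁄dX ℚ (d⁄dX ℚ sinhSeries)) + 6 * d⁄dX ℚ sinhSeries = sinhSeries := by
  have h4 : (4 : ℚ⟦X⟧) = C (4 : ℚ) := (map_ofNat C 4).symm
  have h6 : (6 : ℚ⟦X⟧) = C (6 : ℚ) := (map_ofNat C 6).symm
  ext n
  rw [map_add, h4, h6, coeff_C_mul, coeff_C_mul, coeff_X_mul_derivative, coeff_derivative]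
  simp only [sinhSeries, coeff_mk]
  rw [show 2 * (n + 1) + 1 = (2 * n + 1) + 1 + 1 by ring, Nat.factorial_succ, Nat.factorial_succ]
  have : ((2 * n + 1)! : ℚ) ≠ 0 := by positivity
  push_cast
  field_simp
  ring

/-- The second-order linear equation becomes a Riccati equation for the logarithmic derivative. It
is checked after multiplication by `sinhSeries`, which is then removed by its inverse. -/
theorem sinhLog_ode : 4 * (X * d⁄dX ℚ sinhLog) + 4 * sinhLog ^ 2 + 2 * sinhLog = X := by
  have h := congrArg (d⁄dX ℚ) sinhSeries_logDeriv
  rw [Derivation.leibniz, Derivation.leibniz, derivative_X, smul_eq_mul, smul_eq_mul, smul_eq_mul,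
    smul_eq_mul] at h
  have h1 := sinhSeries_logDeriv
  have h2 := sinhSeries_ode
  have h3 := sinhInv_mul_sinhSeries
  set f := sinhSeries
  set g := sinhInv
  set P := sinhLog
  set f' := d⁄dX ℚ f
  have key : (4 * (X * d⁄dX ℚ P) + 4 * P ^ 2 + 2 * P) * f = X * f := by
    linear_combination (-4 * X) * h + X * h2 + (-4 * P - 2) * h1
  calc _ = (4 * (X * d⁄dX ℚ P) + 4 * P ^ 2 + 2 * P) * f * g := by
        rw [mul_assoc, mul_comm f, h3, mul_one]
    _ = X := by rw [key, mul_assoc, mul_comm f, h3, mul_one]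

theorem coeff_zero_sinhLog : coeff 0 sinhLog = 0 := by
  simp [sinhLog, mul_assoc]

theorem coeff_one_sinhLog : coeff 1 sinhLog = 1 / 6 := by
  have h := congrArg (coeff 1) sinhLog_ode
  have h4 : (4 : ℚ⟦X⟧) = C (4 : ℚ) := (map_ofNat C 4).symm
  have h2 : (2 : ℚ⟦X⟧) = C (2 : ℚ) := (map_ofNat C 2).symm
  rw [map_add, map_add, h4, h2, coeff_C_mul, coeff_C_mul, coeff_C_mul, coeff_X_mul_derivative,
    coeff_one_X, pow_two, coeff_mul, Finset.Nat.sum_antidiagonal_succ] at h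
  simp only [Finset.Nat.antidiagonal_zero, Finset.sum_singleton, zero_add, coeff_zero_sinhLog] at h
  norm_num at h
  linarith

/-- The higher coefficients of the Riccati equation. Up to the sign of the coefficients, this is the
recursion satisfied by the ζ_R(2n). -/
theorem sinhLog_convolution (t : ℕ) :
    2 * ∑ q ∈ antidiagonal t, coeff (q.1 + 1) sinhLog * coeff (q.2 + 1) sinhLog =
      -(2 * t + 5) * coeff (t + 2) sinhLog := by
  have h := congrArg (coeff (t + 2)) sinhLog_ode
  have h4 : (4 : ℚ⟦X⟧) = C (4 : ℚ) := (map_ofNat C 4).symm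
  have h2 : (2 : ℚ⟦X⟧) = C (2 : ℚ) := (map_ofNat C 2).symm
  rw [map_add, map_add, h4, h2, coeff_C_mul, coeff_C_mul, coeff_C_mul, coeff_X_mul_derivative,
    coeff_X, if_neg (by omega), pow_two, coeff_mul, Finset.Nat.sum_antidiagonal_succ,
    Finset.Nat.sum_antidiagonal_succ'] at h
  simp only [coeff_zero_sinhLog, zero_mul, mul_zero, zero_add] at h
  push_cast at h
  linear_combination h / 2

end HyperbolicSine

/-! ### Products over roots of unity and the rationality of the inner sums. -/

section RootsOfUnity

open PowerSeries

theorem derivative_rescale {A : Type*} [CommRing A] (c : A) (g : A⟦X⟧) :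
    X * d⁄dX A (rescale c g) = rescale c (X * d⁄dX A g) := by
  ext n
  rw [coeff_rescale, coeff_X_mul_derivative, coeff_X_mul_derivative, coeff_rescale]
  ring

theorem logDeriv_prod {A ι : Type*} [CommRing A] (s : Finset ι) (P g : ι → A⟦X⟧)
    (h : ∀ i ∈ s, X * d⁄dX A (g i) = P i * g i) :
    X * d⁄dX A (∏ i ∈ s, g i) = (∑ i ∈ s, P i) * ∏ i ∈ s, g i := by
  classical
  induction s using Finset.induction_on with
  | empty => simp
  | insert i s hi ih =>
    have h1 := h i (Finset.mem_insert_self _ _)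
    have h2 := ih fun j hj => h j (Finset.mem_insert_of_mem hj)
    rw [Finset.prod_insert hi, Finset.sum_insert hi, Derivation.leibniz, smul_eq_mul, smul_eq_mul]
    linear_combination (∏ i ∈ s, g i) * h1 + g i * h2

theorem isPrimitiveRoot_rho_sq {m : ℕ} (hm : 1 ≤ m) : IsPrimitiveRoot (rho m ^ 2) m := by
  have h := Complex.isPrimitiveRoot_exp m (by omega)
  have : rho m ^ 2 = Complex.exp (2 * Real.pi * Complex.I / m) := by
    rw [rho, ← Complex.exp_nat_mul]
    congr 1
    push_cast
    ring
  rwa [this]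

theorem sum_root_pow {m : ℕ} {ω : ℂ} (hω : IsPrimitiveRoot ω m) (n : ℕ) :
    ∑ i : Fin m, (ω ^ (i : ℕ)) ^ n = if m ∣ n then (m : ℂ) else 0 := by
  rw [Fin.sum_univ_eq_sum_range (fun i => (ω ^ i) ^ n)]
  simp only [pow_right_comm ω _ n]
  split_ifs with h
  · simp [(hω.pow_eq_one_iff_dvd n).2 h]
  · have h1 : ω ^ n ≠ 1 := fun h' => h ((hω.pow_eq_one_iff_dvd n).1 h')
    have h2 := geom_sum_mul (ω ^ n) m
    rw [pow_right_comm, hω.pow_eq_one, one_pow, sub_self] at h2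
    exact (mul_eq_zero.1 h2).resolve_right (sub_ne_zero.2 h1)

theorem sum_antidiagonal_dvd {A : Type*} [CommRing A] {m : ℕ} (hm : 1 ≤ m) (f : ℕ → ℕ → A) (t : ℕ) :
    ∑ q ∈ antidiagonal (m * t), (if m ∣ q.1 then f q.1 q.2 else 0) =
      ∑ q ∈ antidiagonal t, f (m * q.1) (m * q.2) := by
  symm
  refine Finset.sum_of_injOn (fun q => (m * q.1, m * q.2)) ?_ ?_ ?_ ?_
  · rintro ⟨a, b⟩ _ ⟨c, d⟩ _ h
    simp only [Prod.mk.injEq] at h ⊢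
    exact ⟨Nat.eq_of_mul_eq_mul_left hm h.1, Nat.eq_of_mul_eq_mul_left hm h.2⟩
  · rintro ⟨a, b⟩ h
    simp only [Finset.mem_coe, mem_antidiagonal] at h ⊢
    rw [← mul_add, h]
  · rintro ⟨a, b⟩ h h'
    rw [if_neg]
    rintro ⟨c, rfl⟩
    simp only [mem_antidiagonal] at h
    obtain ⟨d, rfl⟩ : m ∣ b := (Nat.dvd_add_right (dvd_mul_right m c)).1 (h ▸ dvd_mul_right m t)
    rw [← mul_add] at h
    exact h' ⟨(c, d), by simpa using Nat.eq_of_mul_eq_mul_left hm h, rfl⟩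
  · rintro ⟨a, b⟩ _
    simp

/-- The coefficients of `∏ᵢ g(ωⁱ t)` at the multiples of `m`, for a rational series `g`. -/
theorem coeff_prod_rescale {m : ℕ} (hm : 1 ≤ m) {ω : ℂ} (hω : IsPrimitiveRoot ω m)
    {P g : ℚ⟦X⟧} (hg0 : constantCoeff g = 1) (hP0 : coeff 0 P = 0)
    (hg : X * d⁄dX ℚ g = P * g) (n : ℕ) :
    coeff (m * n) (∏ i : Fin m, rescale (ω ^ (i : ℕ)) (map (algebraMap ℚ ℂ) g)) =
      (newtonSeq (fun j => coeff (m * j) P) n : ℂ) := by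
  set G := ∏ i : Fin m, rescale (ω ^ (i : ℕ)) (map (algebraMap ℚ ℂ) g) with hG
  have hd : X * d⁄dX ℂ G =
      (∑ i : Fin m, rescale (ω ^ (i : ℕ)) (map (algebraMap ℚ ℂ) P)) * G := by
    refine logDeriv_prod _ _ _ fun i _ => ?_
    rw [derivative_rescale, ← map_mul, ← map_mul, ← hg]
    congr 1
    ext n
    rw [coeff_X_mul_derivative, coeff_map, coeff_map, coeff_X_mul_derivative]
    simp
  have h0 : coeff (m * 0) G = 1 := by
    rw [mul_zero, coeff_zero_eq_constantCoeff_apply, hG, map_prod]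
    refine Finset.prod_eq_one fun i _ => ?_
    rw [← coeff_zero_eq_constantCoeff_apply, coeff_rescale, coeff_map,
      coeff_zero_eq_constantCoeff_apply, hg0, pow_zero, one_mul, map_one]
  have key := eq_newtonSeq_smul (K := ℂ) (p := fun j => coeff (m * j) P) (by simpa using hP0) (1 : ℂ)
    (s := fun n => coeff (m * n) G) h0 (fun n => ?_) n
  · simpa using key
  · have h := congrArg (coeff (m * n)) hd
    rw [coeff_X_mul_derivative, coeff_mul] at h
    -- Summing P(ωⁱt) over i keeps only exponents divisible by m, multiplied by m. At degree mn the
    -- derivative also yields a factor m, and cancelling it leaves Newton's recursion in n.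
    have hs : ∀ j, coeff j (∑ i : Fin m, rescale (ω ^ (i : ℕ)) (map (algebraMap ℚ ℂ) P)) =
        if m ∣ j then (m : ℂ) * (coeff j P : ℚ) else 0 := by
      intro j
      rw [map_sum]
      simp only [coeff_rescale, coeff_map, ← Finset.sum_mul]
      rw [sum_root_pow hω, ite_mul, zero_mul]
      rfl
    simp only [hs, ite_mul, zero_mul] at h
    rw [sum_antidiagonal_dvd hm (fun i j => (m : ℂ) * (coeff i P : ℚ) * coeff j G)] at h
    simp only [mul_assoc, ← Finset.mul_sum, Nat.cast_mul] at h
    simpa using mul_left_cancel₀ (by exact_mod_cast (by omega : m ≠ 0)) h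

theorem coeff_prod_fin {A : Type*} [CommRing A] {m : ℕ} (g : Fin m → A⟦X⟧) (n : ℕ) :
    coeff n (∏ i, g i) =
      ∑ ν ∈ Finset.piAntidiag (Finset.univ : Finset (Fin m)) n, ∏ i, coeff (ν i) (g i) := by
  classical
  rw [coeff_prod]
  exact Finset.sum_equiv Finsupp.equivFunOnFinite (fun l => by simp) (fun l _ => rfl)

theorem constantCoeff_sinhSeries : constantCoeff sinhSeries = 1 := by
  rw [← coeff_zero_eq_constantCoeff_apply]
  simp [sinhSeries]

theorem constantCoeff_sinhInv : constantCoeff sinhInv = 1 := by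
  rw [← coeff_zero_eq_constantCoeff_apply]
  norm_num [sinhInv]

/-- The sequence of the rational numbers `∑ ∏ 1 / (2lᵢ + 1)! ρ_m^{∑ 2ilᵢ}`. -/
noncomputable def elemSeq (m : ℕ) : ℕ → ℚ := newtonSeq fun j => coeff (m * j) sinhLog

/-- The sequence of the rational numbers `∑ ∏ (2 - 4^{nᵢ}) B_{2nᵢ} / (2nᵢ)! ρ_m^{∑ 2inᵢ}`. -/
noncomputable def homSeq (m : ℕ) : ℕ → ℚ := newtonSeq fun j => coeff (m * j) (-sinhLog)

/-- With ω = ρ_m², the power of ρ_m splits over the factors, so the double sum is the product of the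
coefficients of ∏ g(ωⁱt) for g = `sinhInv` in degree mp and g = `sinhSeries` in degree mq. -/
theorem innerSum_eq {m : ℕ} (hm : 1 ≤ m) (p q : ℕ) :
    innerSum m p q = ((homSeq m p * elemSeq m q : ℚ) : ℂ) := by
  have hω := isPrimitiveRoot_rho_sq hm
  rw [Rat.cast_mul, homSeq, elemSeq,
    ← coeff_prod_rescale hm hω constantCoeff_sinhInv (by simp [sinhLog, mul_assoc]) sinhInv_logDeriv,
    ← coeff_prod_rescale hm hω constantCoeff_sinhSeries coeff_zero_sinhLog sinhSeries_logDeriv,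
    coeff_prod_fin, coeff_prod_fin, Finset.sum_mul_sum, innerSum]
  refine Finset.sum_congr rfl fun ν _ => Finset.sum_congr rfl fun l _ => ?_
  rw [← Finset.prod_pow_eq_pow_sum, ← Finset.prod_mul_distrib, ← Finset.prod_mul_distrib]
  refine Finset.prod_congr rfl fun i _ => ?_
  simp only [coeff_rescale, coeff_map, sinhInv, sinhSeries, coeff_mk, eq_ratCast]
  push_cast
  rw [← pow_mul, ← pow_mul, ← pow_mul, ← pow_mul, mul_add, pow_add, ← mul_assoc, ← mul_assoc]
  ring

end RootsOfUnity

/-! ### Evaluation of the even zeta values and of the restricted sums. -/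

section Evaluation

open PowerSeries

variable {K : Type*} [Field K] {R : Type*} [CommRing R] [Algebra K R]

/-- The generating series of `ζ_R(ak)`. -/
noncomputable def powerSumSeries (Z : h0 K →ₗ[K] R) (a : ℕ) : R⟦X⟧ :=
  PowerSeries.mk fun k => if k = 0 then 0 else extension Z (z K (a * k))

theorem elemZeta_mul_homZeta {Z : h0 K →ₗ[K] R} (hZ : DoubleShuffle Z) {a : ℕ} (ha : 2 ≤ a) :
    PowerSeries.mk (elemZeta Z a) * PowerSeries.mk (homZeta Z a) = 1 := by
  ext k
  simp only [coeff_mul, coeff_mk, coeff_one]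
  exact sum_elemZeta_mul_homZeta hZ ha k

theorem elemZeta_logDeriv [CharZero K] {Z : h0 K →ₗ[K] R} (hZ : DoubleShuffle Z) {a : ℕ} (ha : 2 ≤ a) :
    X * d⁄dX R (PowerSeries.mk (elemZeta Z a)) =
      -powerSumSeries Z a * PowerSeries.mk (elemZeta Z a) := by
  have h : powerSumSeries Z a =
      -(X * d⁄dX R (PowerSeries.mk (elemZeta Z a)) * PowerSeries.mk (homZeta Z a)) := by
    ext k
    rw [map_neg, coeff_mul]
    simp only [coeff_X_mul_derivative, coeff_mk, powerSumSeries]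
    split_ifs with hk
    · simp [hk]
    · exact newton_elemZeta hZ ha (Nat.pos_of_ne_zero hk)
  rw [h]
  linear_combination (-(X * d⁄dX R (PowerSeries.mk (elemZeta Z a)))) * elemZeta_mul_homZeta hZ ha

theorem homZeta_logDeriv [CharZero K] {Z : h0 K →ₗ[K] R} (hZ : DoubleShuffle Z) {a : ℕ} (ha : 2 ≤ a) :
    X * d⁄dX R (PowerSeries.mk (homZeta Z a)) =
      powerSumSeries Z a * PowerSeries.mk (homZeta Z a) := by
  have h1 := elemZeta_logDeriv hZ ha
  have h2 := elemZeta_mul_homZeta hZ ha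
  have h := congrArg (d⁄dX R) h2
  rw [Derivation.leibniz, derivative_one, smul_eq_mul, smul_eq_mul] at h
  set E := PowerSeries.mk (elemZeta Z a)
  set F := PowerSeries.mk (homZeta Z a)
  linear_combination X * F * h - (X * d⁄dX R F - powerSumSeries Z a * F) * h2 - F ^ 2 * h1

variable {L : Type*} [CommRing L] [Algebra K L] [Algebra R L]

/-- `λ² / 4`. -/
noncomputable def quarterSq (K : Type*) [Field K] {L : Type*} [CommRing L] [Algebra K L]
    (lam : L) : L := (1 / 4 : K) • lam ^ 2

theorem quarterSq_pow (lam : L) (n : ℕ) :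
    quarterSq K lam ^ n = (1 / 4 ^ n : K) • lam ^ (2 * n) := by
  rw [quarterSq, smul_pow, pow_mul, one_div_pow]

/-- Euler's formula. -/
theorem zeta_even_eq [CharZero K] {Z : h0 K →ₗ[K] R} (hZ : RegularizedDoubleShuffle Z) (lam : L)
    (hlam : lam ^ 2 = algebraMap R L (-24 * zeta Z [2] admissible_two)) {n : ℕ} (hn : 1 ≤ n) :
    algebraMap R L (extension Z (z K (2 * n))) =
      ((coeff n (-sinhLog) : ℚ) : K) • quarterSq K lam ^ n := by
  induction n using Nat.strong_induction_on with
  | _ n ih =>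
    rcases Nat.lt_or_ge n 2 with h2 | h2
    · obtain rfl : n = 1 := by omega
      rw [zeta_eq_extension, zWord_cons, zWord_nil, mul_one] at hlam
      have e : algebraMap R L (-24 * extension Z (z K 2)) =
          (-24 : K) • algebraMap R L (extension Z (z K 2)) := by
        rw [map_mul, Algebra.smul_def, map_neg, map_neg, map_ofNat, map_ofNat]
      rw [map_neg, coeff_one_sinhLog, pow_one, quarterSq, hlam, e, smul_smul, smul_smul]
      norm_num
    · obtain ⟨t, rfl⟩ := Nat.exists_eq_add_of_le' h2
      have h := congrArg (algebraMap R L) (hZ.sum_even_zeta t)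
      rw [map_mul, map_mul, map_sum] at h
      have e : ∀ q ∈ antidiagonal t, algebraMap R L
          (extension Z (z K (2 * q.1 + 2)) * extension Z (z K (2 * q.2 + 2))) =
          ((coeff (q.1 + 1) sinhLog * coeff (q.2 + 1) sinhLog : ℚ) : K) •
            quarterSq K lam ^ (t + 2) := by
        intro q hq
        have hq := mem_antidiagonal.1 hq
        rw [map_mul, show 2 * q.1 + 2 = 2 * (q.1 + 1) by ring,
          show 2 * q.2 + 2 = 2 * (q.2 + 1) by ring, ih _ (by omega) (by omega),
          ih _ (by omega) (by omega), smul_mul_smul_comm, ← pow_add, ← Rat.cast_mul, map_neg,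
          map_neg, neg_mul_neg, show q.1 + 1 + (q.2 + 1) = t + 2 by omega]
      rw [Finset.sum_congr rfl e, ← Finset.sum_smul, ← Rat.cast_sum] at h
      -- The integer factors are moved to the field K, where 2t + 5 can be cancelled.
      have h2 : algebraMap R L 2 = algebraMap K L 2 := by rw [map_ofNat, map_ofNat]
      have h5 : algebraMap R L (2 * t + 5) = algebraMap K L (2 * t + 5) := by
        rw [map_add, map_add, map_mul, map_mul, h2, map_natCast, map_natCast, map_ofNat, map_ofNat,
          map_ofNat]
      have h6 : (2 * t + 5 : K) ≠ 0 := by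
        have : ((2 * t + 5 : ℕ) : K) ≠ 0 := Nat.cast_ne_zero.2 (by omega)
        exact_mod_cast this
      rw [h2, h5, ← Algebra.smul_def, ← Algebra.smul_def, smul_smul] at h
      have h7 : (2 : K) * ((∑ q ∈ antidiagonal t,
          coeff (q.1 + 1) sinhLog * coeff (q.2 + 1) sinhLog : ℚ) : K) =
          (2 * t + 5) * ((coeff (t + 2) (-sinhLog) : ℚ) : K) := by
        have := congrArg (Rat.cast : ℚ → K) (sinhLog_convolution t)
        push_cast at this ⊢
        rw [this, map_neg]
        push_cast
        ring
      rw [h7, mul_smul] at h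
      exact (smul_right_injective L h6 h).symm

theorem eq_newtonSeq_of_logDeriv {K R L : Type*} [Field K] [CharZero K] [CommRing R] [CommRing L]
    [Algebra K L] [Algebra R L] {g P : R⟦X⟧} (h : X * d⁄dX R g = P * g) (hg : coeff 0 g = 1)
    {p : ℕ → ℚ} (hp : p 0 = 0) {M : L}
    (hP : ∀ j, algebraMap R L (coeff j P) = (p j : K) • M ^ j) (n : ℕ) :
    algebraMap R L (coeff n g) = (newtonSeq p n : K) • M ^ n := by
  refine eq_newtonSeq_smul hp M (s := fun n => algebraMap R L (coeff n g)) (by simp [hg])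
    (fun n => ?_) n
  have h := congrArg (coeff n) h
  rw [coeff_X_mul_derivative, coeff_mul] at h
  simpa only [map_sum, map_mul, hP, map_natCast] using congrArg (algebraMap R L) h

theorem algebraMap_smul_tower [IsScalarTower K R L] (c : K) (x : R) :
    algebraMap R L (c • x) = c • algebraMap R L x :=
  map_smul (IsScalarTower.toAlgHom K R L) c x

theorem powerSumSeries_eq [CharZero K] {Z : h0 K →ₗ[K] R} (hZ : RegularizedDoubleShuffle Z) (lam : L)
    (hlam : lam ^ 2 = algebraMap R L (-24 * zeta Z [2] admissible_two)) {m : ℕ} (hm : 1 ≤ m)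
    (j : ℕ) : algebraMap R L (coeff j (powerSumSeries Z (2 * m))) =
    ((coeff (m * j) (-sinhLog) : ℚ) : K) • (quarterSq K lam ^ m) ^ j := by
  rw [powerSumSeries, coeff_mk]
  split_ifs with h
  · simp [h, sinhLog, mul_assoc]
  · rw [mul_assoc, zeta_even_eq hZ lam hlam (Nat.mul_pos hm (Nat.pos_of_ne_zero h)), pow_mul]

theorem elemZeta_eq [CharZero K] {Z : h0 K →ₗ[K] R} (hZ : RegularizedDoubleShuffle Z) (lam : L)
    (hlam : lam ^ 2 = algebraMap R L (-24 * zeta Z [2] admissible_two)) {m : ℕ} (hm : 1 ≤ m)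
    (i : ℕ) : algebraMap R L (elemZeta Z (2 * m) i) =
    (elemSeq m i : K) • (quarterSq K lam ^ m) ^ i := by
  have h := eq_newtonSeq_of_logDeriv (L := L) (K := K)
    (elemZeta_logDeriv hZ.toDoubleShuffle (a := 2 * m) (by omega))
    (by rw [coeff_mk, elemZeta_zero hZ.toDoubleShuffle])
    (p := fun j => coeff (m * j) sinhLog) (by simpa using coeff_zero_sinhLog)
    (M := quarterSq K lam ^ m) (fun j => by
      rw [map_neg, map_neg, powerSumSeries_eq hZ lam hlam hm, map_neg, Rat.cast_neg, neg_smul,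
        neg_neg]) i
  rwa [coeff_mk] at h

theorem homZeta_eq [CharZero K] {Z : h0 K →ₗ[K] R} (hZ : RegularizedDoubleShuffle Z) (lam : L)
    (hlam : lam ^ 2 = algebraMap R L (-24 * zeta Z [2] admissible_two)) {m : ℕ} (hm : 1 ≤ m)
    (i : ℕ) : algebraMap R L (homZeta Z (2 * m) i) =
    (homSeq m i : K) • (quarterSq K lam ^ m) ^ i := by
  have h0 : homZeta Z (2 * m) 0 = 1 := by
    rw [homZeta, wordSeries_zero, hZ.toDoubleShuffle.extension_one]
  have h := eq_newtonSeq_of_logDeriv (L := L) (K := K)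
    (homZeta_logDeriv hZ.toDoubleShuffle (a := 2 * m) (by omega)) (by rw [coeff_mk, h0])
    (p := fun j => coeff (m * j) (-sinhLog)) (by simp [sinhLog, mul_assoc])
    (M := quarterSq K lam ^ m) (powerSumSeries_eq hZ lam hlam hm) i
  rwa [coeff_mk] at h

theorem elemZeta_mul_homZeta_eq [CharZero K] {Z : h0 K →ₗ[K] R} (hZ : RegularizedDoubleShuffle Z) (lam : L)
    (hlam : lam ^ 2 = algebraMap R L (-24 * zeta Z [2] admissible_two)) {m : ℕ} (hm : 1 ≤ m)
    {k : ℕ} {q : ℕ × ℕ} (hq : q ∈ antidiagonal k) :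
    algebraMap R L (elemZeta Z (2 * m) q.1 * homZeta Z (2 * m) q.2) =
      ((homSeq m q.2 * elemSeq m q.1 / 4 ^ (k * m) : ℚ) : K) • lam ^ (2 * k * m) := by
  rw [map_mul, elemZeta_eq hZ lam hlam hm, homZeta_eq hZ lam hlam hm, smul_mul_smul_comm,
    ← pow_add, mem_antidiagonal.1 hq, ← pow_mul, quarterSq_pow, smul_smul, mul_comm m k,
    ← mul_assoc 2 k m]
  congr 1
  push_cast
  ring

theorem algebraMap_restrictedSum [CharZero K] [IsScalarTower K R L] {Z : h0 K →ₗ[K] R} (hZ : RegularizedDoubleShuffle Z) (lam : L)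
    (hlam : lam ^ 2 = algebraMap R L (-24 * zeta Z [2] admissible_two)) {m : ℕ} (hm : 1 ≤ m)
    {k n : ℕ} (hn : n ≤ k) (h2 : 2 ≤ 2 * m) :
    algebraMap R L (restrictedSum Z h2 k n) =
      ((((-1) ^ n * ∑ j ∈ Finset.range (k - n + 1), ((k - j).choose n : ℚ) *
        (homSeq m j * elemSeq m (k - j))) / 4 ^ (k * m) : ℚ) : K) • lam ^ (2 * k * m) := by
  rw [restrictedSum_eq hZ.toDoubleShuffle h2 hn, map_sum]
  have e : ∀ q ∈ antidiagonal k, algebraMap R L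
      (((-1) ^ n * (q.1.choose n : K)) • (elemZeta Z (2 * m) q.1 * homZeta Z (2 * m) q.2)) =
      (((-1) ^ n * (q.1.choose n : ℚ) * (homSeq m q.2 * elemSeq m q.1) / 4 ^ (k * m) : ℚ) : K) •
        lam ^ (2 * k * m) := by
    intro q hq
    rw [algebraMap_smul_tower, elemZeta_mul_homZeta_eq hZ lam hlam hm hq, smul_smul]
    congr 1
    push_cast
    ring
  suffices h : ∑ q ∈ antidiagonal k, (q.1.choose n : ℚ) * (homSeq m q.2 * elemSeq m q.1) =
      ∑ j ∈ Finset.range (k - n + 1), ((k - j).choose n : ℚ) *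
        (homSeq m j * elemSeq m (k - j)) by
    rw [Finset.sum_congr rfl e, ← Finset.sum_smul, ← Rat.cast_sum, ← Finset.sum_div]
    simp only [mul_assoc ((-1 : ℚ) ^ n), ← Finset.mul_sum, h]
  rw [← Finset.Nat.sum_antidiagonal_swap, Finset.Nat.sum_antidiagonal_eq_sum_range_succ_mk]
  symm
  refine Finset.sum_subset (Finset.range_mono (by omega)) fun j hj' hj => ?_
  rw [Finset.mem_range] at hj hj'
  rw [Nat.choose_eq_zero_of_lt (show k - j < n by omega), Nat.cast_zero, zero_mul]

theorem algebraMap_restrictedSumStar [CharZero K] [IsScalarTower K R L] {Z : h0 K →ₗ[K] R} (hZ : RegularizedDoubleShuffle Z) (lam : L)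
    (hlam : lam ^ 2 = algebraMap R L (-24 * zeta Z [2] admissible_two)) {m : ℕ} (hm : 1 ≤ m)
    {k n : ℕ} (hn : n ≤ k) (h2 : 2 ≤ 2 * m) :
    algebraMap R L (restrictedSumStar Z h2 k n) =
      (((∑ j ∈ Finset.Icc n k, (j.choose n : ℚ) *
        (homSeq m j * elemSeq m (k - j))) / 4 ^ (k * m) : ℚ) : K) • lam ^ (2 * k * m) := by
  rw [restrictedSumStar_eq hZ.toDoubleShuffle h2 hn, map_sum]
  have e : ∀ q ∈ antidiagonal k, algebraMap R L
      ((q.2.choose n : K) • (elemZeta Z (2 * m) q.1 * homZeta Z (2 * m) q.2)) =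
      (((q.2.choose n : ℚ) * (homSeq m q.2 * elemSeq m q.1) / 4 ^ (k * m) : ℚ) : K) •
        lam ^ (2 * k * m) := by
    intro q hq
    rw [algebraMap_smul_tower, elemZeta_mul_homZeta_eq hZ lam hlam hm hq, smul_smul]
    congr 1
    push_cast
    ring
  suffices h : ∑ q ∈ antidiagonal k, (q.2.choose n : ℚ) * (homSeq m q.2 * elemSeq m q.1) =
      ∑ j ∈ Finset.Icc n k, (j.choose n : ℚ) * (homSeq m j * elemSeq m (k - j)) by
    rw [Finset.sum_congr rfl e, ← Finset.sum_smul, ← Rat.cast_sum, ← Finset.sum_div, h]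
  rw [← Finset.Nat.sum_antidiagonal_swap, Finset.Nat.sum_antidiagonal_eq_sum_range_succ_mk]
  symm
  refine Finset.sum_subset (fun j hj => ?_) fun j hj' hj => ?_
  · rw [Finset.mem_Icc] at hj
    exact Finset.mem_range.2 (by omega)
  · rw [Finset.mem_range] at hj'
    rw [Finset.mem_Icc] at hj
    rw [Nat.choose_eq_zero_of_lt (show j < n by omega), Nat.cast_zero, zero_mul]

end Evaluation

/-! ### Closed forms for m = 1 and m = 2. -/

section SmallCases

open PowerSeries

theorem coeff_eq_newtonSeq {P g : ℚ⟦X⟧} (hg0 : constantCoeff g = 1) (hP0 : coeff 0 P = 0)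
    (hg : X * d⁄dX ℚ g = P * g) (n : ℕ) : newtonSeq (fun j => coeff (1 * j) P) n = coeff n g := by
  have h := coeff_prod_rescale le_rfl IsPrimitiveRoot.one hg0 hP0 hg n
  rw [Fin.prod_univ_one, one_mul, coeff_rescale, coeff_map] at h
  simpa using h.symm

theorem homSeq_one (n : ℕ) : homSeq 1 n = (2 - 4 ^ n) * bernoulli (2 * n) / (2 * n)! := by
  rw [homSeq, coeff_eq_newtonSeq constantCoeff_sinhInv (by simp [sinhLog, mul_assoc])
    sinhInv_logDeriv, sinhInv, coeff_mk]

theorem elemSeq_one (n : ℕ) : elemSeq 1 n = 1 / (2 * n + 1)! := by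
  rw [elemSeq, coeff_eq_newtonSeq constantCoeff_sinhSeries coeff_zero_sinhLog
    sinhSeries_logDeriv, sinhSeries, coeff_mk]

/-- The product over the square roots of unity is g(t) g(-t). The sign may sit on either index, as
they add up to an even number. -/
theorem newtonSeq_two {P g : ℚ⟦X⟧} (hg0 : constantCoeff g = 1) (hP0 : coeff 0 P = 0)
    (hg : X * d⁄dX ℚ g = P * g) (n : ℕ) : newtonSeq (fun j => coeff (2 * j) P) n =
      ∑ q ∈ antidiagonal (2 * n), (-1) ^ q.1 * (coeff q.1 g * coeff q.2 g) := by
  have h := coeff_prod_rescale one_le_two (IsPrimitiveRoot.neg_one 0 two_ne_zero.symm) hg0 hP0 hg n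
  rw [Fin.prod_univ_two, coeff_mul] at h
  simp only [coeff_rescale, coeff_map, Fin.val_zero, Fin.val_one, pow_zero, pow_one, one_pow,
    one_mul, eq_ratCast] at h
  have h' : ((∑ q ∈ antidiagonal (2 * n), (-1) ^ q.1 * (coeff q.1 g * coeff q.2 g) : ℚ) : ℂ) =
      (newtonSeq (fun j => coeff (2 * j) P) n : ℂ) := by
    rw [← h]
    push_cast
    refine Finset.sum_congr rfl fun q hq => ?_
    rw [neg_one_pow_congr (m := q.1) (n := q.2) (by
      rw [← Nat.even_add, mem_antidiagonal.1 hq]; exact even_two_mul n)]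
    ring
  exact (Rat.cast_injective h').symm

theorem homSeq_two (j : ℕ) : homSeq 2 j = (∑ i ∈ Finset.range (2 * j + 1),
    (-1) ^ i * ((4 * j).choose (2 * i) : ℚ) * (2 - 4 ^ i) * (2 - 4 ^ (2 * j - i)) *
      bernoulli (2 * i) * bernoulli (4 * j - 2 * i)) / (4 * j)! := by
  rw [homSeq, newtonSeq_two constantCoeff_sinhInv (by simp [sinhLog, mul_assoc]) sinhInv_logDeriv,
    Finset.Nat.sum_antidiagonal_eq_sum_range_succ_mk, Finset.sum_div]
  refine Finset.sum_congr rfl fun i hi => ?_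
  have hi := Finset.mem_range.1 hi
  simp only [sinhInv, coeff_mk]
  rw [Nat.cast_choose ℚ (show 2 * i ≤ 4 * j by omega),
    show 4 * j - 2 * i = 2 * (2 * j - i) by omega]
  have : ((4 * j)! : ℚ) ≠ 0 := by positivity
  field_simp

theorem sum_antidiagonal_pow_div_factorial (c : ℂ) (n : ℕ) :
    ∑ q ∈ antidiagonal n, c ^ q.1 / ((q.1)! * (q.2)!) = (c + 1) ^ n / n ! := by
  rw [(Commute.all c 1).add_pow', Finset.sum_div]
  refine Finset.sum_congr rfl fun q hq => ?_
  have : (n ! : ℂ) ≠ 0 := by exact_mod_cast n.factorial_ne_zero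
  rw [← mem_antidiagonal.1 hq] at this ⊢
  rw [nsmul_eq_mul, Nat.cast_add_choose, one_pow, mul_one]
  field_simp

/-- The sum of (-1)^p / ((2p + 1)! (2q + 1)!) is, up to a factor i, the odd part of the binomial
expansion of (1 + i)^{4n+2} / (4n + 2)!. The odd part is half the difference with the conjugate
expression, and (1 + i)² = 2i. -/
theorem elemSeq_two (n : ℕ) : elemSeq 2 n = (-1) ^ n * 2 * 4 ^ n / (4 * n + 2)! := by
  rw [elemSeq, newtonSeq_two constantCoeff_sinhSeries coeff_zero_sinhLog sinhSeries_logDeriv]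
  have h1 := sum_antidiagonal_pow_div_factorial Complex.I (4 * n + 2)
  have h2 := sum_antidiagonal_pow_div_factorial (-Complex.I) (4 * n + 2)
  have e1 : (Complex.I + 1) ^ (4 * n + 2) = Complex.I * ((-1) ^ n * 2 * 4 ^ n) := by
    rw [show 4 * n + 2 = 2 * (2 * n + 1) by ring, pow_mul,
      show (Complex.I + 1) ^ 2 = 2 * Complex.I by linear_combination Complex.I_sq,
      mul_pow, pow_succ, pow_succ, pow_mul, pow_mul, Complex.I_sq]
    norm_num
    ring
  have e2 : (-Complex.I + 1) ^ (4 * n + 2) = -(Complex.I * ((-1) ^ n * 2 * 4 ^ n)) := by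
    rw [show 4 * n + 2 = 2 * (2 * n + 1) by ring, pow_mul,
      show (-Complex.I + 1) ^ 2 = -(2 * Complex.I) by linear_combination Complex.I_sq,
      Odd.neg_pow (odd_two_mul_add_one n), mul_pow, pow_succ, pow_succ, pow_mul, pow_mul,
      Complex.I_sq]
    norm_num
    ring
  rw [e1] at h1
  rw [e2] at h2
  have h3 : ∑ q ∈ antidiagonal (4 * n + 2), (1 - (-1) ^ q.1) *
      (Complex.I ^ q.1 / ((q.1)! * (q.2)!)) =
      2 * (Complex.I * ((-1) ^ n * 2 * 4 ^ n) / (4 * n + 2)!) := by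
    simp only [sub_mul, one_mul, Finset.sum_sub_distrib, h1]
    have : ∀ q : ℕ × ℕ, (-1) ^ q.1 * (Complex.I ^ q.1 / ((q.1)! * (q.2)!)) =
        (-Complex.I) ^ q.1 / ((q.1)! * (q.2)!) := fun q => by
      rw [neg_pow Complex.I, mul_div_assoc]
    simp only [this, h2]
    ring
  rw [Finset.Nat.sum_antidiagonal_succ, Finset.Nat.sum_antidiagonal_succ'] at h3
  have e3 : ∀ q : ℕ × ℕ, (1 - (-1 : ℂ) ^ (q.1 + 1)) *
      (Complex.I ^ (q.1 + 1) / ((q.1 + 1)! * (q.2 + 1)!)) =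
      (1 + (-1) ^ q.1) * (Complex.I ^ (q.1 + 1) / ((q.1 + 1)! * (q.2 + 1)!)) := fun q => by
    rw [pow_succ (-1 : ℂ)]; ring
  have e4 : (-1 : ℂ) ^ (4 * n + 1 + 1) = 1 := by
    rw [show 4 * n + 1 + 1 = 2 * (2 * n + 1) by ring, pow_mul]; simp
  simp only [e3, e4, pow_zero, sub_self, zero_mul, zero_add] at h3
  rw [show 4 * n = 2 * (2 * n) by ring, sum_antidiagonal_even
    (fun a b => Complex.I ^ (a + 1) / (((a + 1)! : ℂ) * (b + 1)!))] at h3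
  have h4 := mul_left_cancel₀ two_ne_zero h3
  have e5 : ∀ q : ℕ × ℕ, Complex.I ^ (2 * q.1 + 1) / (((2 * q.1 + 1)! : ℂ) * (2 * q.2 + 1)!) =
      Complex.I * ((-1) ^ q.1 * (1 / (2 * q.1 + 1)! * (1 / (2 * q.2 + 1)!))) := fun q => by
    rw [pow_succ, pow_mul, Complex.I_sq]
    field_simp
  simp only [e5, ← Finset.mul_sum, mul_div_assoc Complex.I] at h4
  have h5 := mul_left_cancel₀ Complex.I_ne_zero h4
  refine Rat.cast_injective (α := ℂ) ?_
  simp only [sinhSeries, coeff_mk]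
  push_cast
  rw [h5, show 4 * n = 2 * (2 * n) by ring]

end SmallCases

/-! ### Binomial forms of the coefficients, and the main theorem. -/

theorem homSeq_one_mul_elemSeq_one {j k : ℕ} (h : j ≤ k) : homSeq 1 j * elemSeq 1 (k - j) =
    ((2 * k + 1).choose (2 * j) : ℚ) * (2 - 4 ^ j) * bernoulli (2 * j) / (2 * k + 1)! := by
  obtain ⟨q, rfl⟩ := Nat.exists_eq_add_of_le h
  rw [homSeq_one, elemSeq_one, Nat.cast_choose ℚ (by omega), Nat.add_sub_cancel_left,
    show 2 * (j + q) + 1 - 2 * j = 2 * q + 1 by omega]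
  have : ((2 * (j + q) + 1)! : ℚ) ≠ 0 := by positivity
  field_simp

theorem homSeq_two_mul_elemSeq_two {j k : ℕ} (h : j ≤ k) : homSeq 2 j * elemSeq 2 (k - j) =
    4 ^ k * (-1) ^ k * 2 / (4 * k + 2)! * ((-1) ^ j / 4 ^ j * ((4 * k + 2).choose (4 * j) : ℚ) *
      ∑ i ∈ Finset.range (2 * j + 1), (-1) ^ i * ((4 * j).choose (2 * i) : ℚ) *
        (2 - 4 ^ i) * (2 - 4 ^ (2 * j - i)) * bernoulli (2 * i) * bernoulli (4 * j - 2 * i)) := by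
  obtain ⟨q, rfl⟩ := Nat.exists_eq_add_of_le h
  rw [homSeq_two, elemSeq_two, Nat.cast_choose ℚ (by omega), Nat.add_sub_cancel_left,
    show 4 * (j + q) + 2 - 4 * j = 4 * q + 2 by omega]
  have : ((4 * (j + q) + 2)! : ℚ) ≠ 0 := by positivity
  have h1 : ((-1 : ℚ) ^ j) * (-1) ^ j = 1 := by rw [← mul_pow]; simp
  rw [pow_add, pow_add]
  generalize ∑ i ∈ Finset.range (2 * j + 1), (-1) ^ i * ((4 * j).choose (2 * i) : ℚ) *
        (2 - 4 ^ i) * (2 - 4 ^ (2 * j - i)) * bernoulli (2 * i) * bernoulli (4 * j - 2 * i) = b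
  field_simp
  linear_combination (-b) * h1

end MZV

theorem mainTheorem9 {K : Type*} [Field K] [CharZero K] {R : Type*} [CommRing R] [Algebra K R]
    (Z : MZV.h0 K →ₗ[K] R) (hZ : MZV.RegularizedDoubleShuffle Z)
    {L : Type*} [CommRing L] [Algebra K L] [Algebra R L] [IsScalarTower K R L]
    (lam : L) (hlam : lam ^ 2 = algebraMap R L (-24 * MZV.zeta Z [2] MZV.admissible_two))
    (k n : ℕ) (hn : 1 ≤ n) (hk : n ≤ k) :
    (∀ (m : ℕ) (hm : 1 ≤ m),
      (∃ C : ℚ,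
        (C : ℂ) = (-1) ^ n *
          ∑ j ∈ Finset.range (k - n + 1), ((k - j).choose n : ℂ) * MZV.innerSum m j (k - j) ∧
        algebraMap R L (MZV.restrictedSum Z (a := 2 * m) (by omega) k n) =
          ((C / 4 ^ (k * m) : ℚ) : K) • lam ^ (2 * k * m)) ∧
      (∃ C : ℚ,
        (C : ℂ) = ∑ j ∈ Finset.Icc n k, (j.choose n : ℂ) * MZV.innerSum m j (k - j) ∧
        algebraMap R L (MZV.restrictedSumStar Z (a := 2 * m) (by omega) k n) =
          ((C / 4 ^ (k * m) : ℚ) : K) • lam ^ (2 * k * m))) ∧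
    (algebraMap R L (MZV.restrictedSum Z (a := 2) le_rfl k n) =
      (((-1) ^ n / (4 ^ k * (2 * k + 1)! : ℚ) *
        ∑ j ∈ Finset.range (k - n + 1), ((k - j).choose n : ℚ) * ((2 * k + 1).choose (2 * j) : ℚ) *
          (2 - 4 ^ j) * bernoulli (2 * j) : ℚ) : K) • lam ^ (2 * k)) ∧
    (algebraMap R L (MZV.restrictedSumStar Z (a := 2) le_rfl k n) =
      ((1 / (4 ^ k * (2 * k + 1)! : ℚ) *
        ∑ j ∈ Finset.Icc n k, (j.choose n : ℚ) * ((2 * k + 1).choose (2 * j) : ℚ) *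
          (2 - 4 ^ j) * bernoulli (2 * j) : ℚ) : K) • lam ^ (2 * k)) ∧
    (algebraMap R L (MZV.restrictedSum Z (a := 4) (by omega) k n) =
      (((-1) ^ (k + n) * 2 / (4 ^ k * (4 * k + 2)! : ℚ) *
        ∑ j ∈ Finset.range (k - n + 1), (-1) ^ j / 4 ^ j * ((k - j).choose n : ℚ) *
          ((4 * k + 2).choose (4 * j) : ℚ) *
          ∑ i ∈ Finset.range (2 * j + 1), (-1) ^ i * ((4 * j).choose (2 * i) : ℚ) *
            (2 - 4 ^ i) * (2 - 4 ^ (2 * j - i)) *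
            bernoulli (2 * i) * bernoulli (4 * j - 2 * i) : ℚ) : K) • lam ^ (4 * k)) ∧
    (algebraMap R L (MZV.restrictedSumStar Z (a := 4) (by omega) k n) =
      (((-1) ^ k * 2 / (4 ^ k * (4 * k + 2)! : ℚ) *
        ∑ j ∈ Finset.Icc n k, (-1) ^ j / 4 ^ j * (j.choose n : ℚ) *
          ((4 * k + 2).choose (4 * j) : ℚ) *
          ∑ i ∈ Finset.range (2 * j + 1), (-1) ^ i * ((4 * j).choose (2 * i) : ℚ) *
            (2 - 4 ^ i) * (2 - 4 ^ (2 * j - i)) *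
            bernoulli (2 * i) * bernoulli (4 * j - 2 * i) : ℚ) : K) • lam ^ (4 * k)) := by
  have hs := fun m hm => MZV.algebraMap_restrictedSum hZ lam hlam (m := m) hm hk
  have hs' := fun m hm => MZV.algebraMap_restrictedSumStar hZ lam hlam (m := m) hm hk
  -- The rational constants are read off from `hs` and `hs'`, with the products of `homSeq` and
  -- `elemSeq` in place of D; `innerSum_eq` then matches them with the complex sums.
  refine ⟨fun m hm => ⟨⟨_, ?_, hs m hm (by omega)⟩, ⟨_, ?_, hs' m hm (by omega)⟩⟩, ?_, ?_, ?_, ?_⟩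
  · push_cast
    simp only [MZV.innerSum_eq hm]
    push_cast
    rfl
  · push_cast
    simp only [MZV.innerSum_eq hm]
    push_cast
    rfl
  · refine (hs 1 le_rfl le_rfl).trans ?_
    rw [mul_one, mul_one]
    congr 2
    rw [mul_div_right_comm, Finset.mul_sum, Finset.mul_sum]
    refine Finset.sum_congr rfl fun j hj => ?_
    rw [MZV.homSeq_one_mul_elemSeq_one (by have := Finset.mem_range.1 hj; omega)]
    field_simp
  · refine (hs' 1 le_rfl le_rfl).trans ?_
    rw [mul_one, mul_one]
    congr 2
    rw [Finset.sum_div, Finset.mul_sum]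
    refine Finset.sum_congr rfl fun j hj => ?_
    rw [MZV.homSeq_one_mul_elemSeq_one (Finset.mem_Icc.1 hj).2]
    field_simp
  · refine (hs 2 one_le_two (by omega)).trans ?_
    -- One of the two factors 4^k in the denominator cancels against the 4^k supplied by
    -- `homSeq_two_mul_elemSeq_two`.
    rw [show 2 * k * 2 = 4 * k by ring, show k * 2 = k + k by ring, pow_add]
    congr 2
    rw [mul_div_right_comm, Finset.mul_sum, Finset.mul_sum]
    refine Finset.sum_congr rfl fun j hj => ?_
    rw [MZV.homSeq_two_mul_elemSeq_two (by have := Finset.mem_range.1 hj; omega), pow_add]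
    generalize Finset.sum (M := ℚ) (Finset.range (2 * j + 1)) _ = b
    field_simp
  · refine (hs' 2 one_le_two (by omega)).trans ?_
    rw [show 2 * k * 2 = 4 * k by ring, show k * 2 = k + k by ring, pow_add]
    congr 2
    rw [Finset.sum_div, Finset.mul_sum]
    refine Finset.sum_congr rfl fun j hj => ?_
    rw [MZV.homSeq_two_mul_elemSeq_two (Finset.mem_Icc.1 hj).2]
    generalize Finset.sum (M := ℚ) (Finset.range (2 * j + 1)) _ = b
    field_simp
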